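/- Let $(M,g)$ be a flat smooth Riemannian manifold of dimension $m$ (without boundary), with Levi-Civita connection $\nabla$, and let $f:M\to(0,\infty)$ be smooth. For $(x,u)\in TM$ and $X\in T_xM$ let $X^V=X^i\frac{\partial}{\partial y^i}$ and $X^H=X^i\big(\frac{\partial}{\partial x^i}-u^j\Gamma_{ij}^k\frac{\partial}{\partial y^k}\big)$ be the vertical and horizontal lifts of $X$ to $T_{(x,u)}TM$, where $(x^i,y^i)$ are the coordinates of $TM$ induced by coordinates $(x^i)$ of $M$ and $\Gamma_{ij}^k$ are the Christoffel symbols of $g$. The Sasaki metric $\widehat g$ and the Mus-Sasaki metric $\widetilde g$ on $TM$ are given at $(x,u)$ by $$\widehat g(X^H,Y^H)=\widetilde g(X^H,Y^H)=g_x(X,Y),\qquad \widehat g(X^H,Y^V)=\widetilde g(X^H,Y^V)=0,$$ $$\widehat g(X^V,Y^V)=g_x(X,Y),\qquad \widetilde g(X^V,Y^V)=f(x)\,g_x(X,Y).$$ For a smooth map $\varphi:(P,k)\to(N,h)$ of Riemannian manifolds let $\tau(\varphi)=\operatorname{Tr}_k\nabla d\varphi$ be its tension field and $$\tau_2(\varphi)=-\operatorname{Tr}_kR^N(\tau(\varphi),d\varphi)d\varphi-\operatorname{Tr}_k\big(\nabla^\varphi\nabla^\varphi\tau(\varphi)-\nabla^\varphi_{\nabla^P}\tau(\varphi)\big)$$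 its bitension field, where $\nabla^P$ is the Levi-Civita connection of $(P,k)$, $\nabla^\varphi$ is the pull-back of the Levi-Civita connection of $(N,h)$, and $R^N(X,Y)Z=\nabla_X\nabla_YZ-\nabla_Y\nabla_XZ-\nabla_{[X,Y]}Z$. Then the identity map $\widehat{Id}_f:(TM,\widehat g)\to(TM,\widetilde g)$ satisfies $$\tau(\widehat{Id}_f)=-\frac m2\,(\operatorname{grad}f)^H,$$ $$\tau_2(\widehat{Id}_f)=-\frac{m^2}{8}\big(\operatorname{grad}\|\operatorname{grad}f\|^2\big)^H+\frac m2\big(\operatorname{Tr}_g\nabla^2(\operatorname{grad}f)\big)^H,$$ where the gradients and the norm are taken with respect to $g$, and $\operatorname{Tr}_g\nabla^2X=\sum_i\big(\nabla_{E_i}\nabla_{E_i}X-\nabla_{\nabla_{E_i}E_i}X\big)$ for a local $g$-orthonormal frame $(E_i)$. -/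

import Mathlib

set_option maxSynthPendingDepth 3

open Bundle
open scoped Manifold ContDiff

noncomputable section

namespace RiemGeom

/-! ## Tensor calculus in a coordinate domain

`E` is the (finite-dimensional) coordinate space. A metric in coordinates is a function
`G : E → E →L[ℝ] E →L[ℝ] ℝ`; only its germ at the point considered matters. -/

section Coordinates

variable {E : Type*} [NormedAddCommGroup E] [NormedSpace ℝ E]
  {F : Type*} [NormedAddCommGroup F] [NormedSpace ℝ F]

/-- `B(A ·, A ·)`, for a bilinear form `B` and a linear map `A`. -/
def pullbackForm {V W : Type*}
    [TopologicalSpace V] [AddCommGroup V] [Module ℝ V]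
    [TopologicalSpace W] [AddCommGroup W] [Module ℝ W]
    (B : V →L[ℝ] V →L[ℝ] ℝ) (A : W →L[ℝ] V) : W →L[ℝ] W →L[ℝ] ℝ :=
  (ContinuousLinearMap.precomp ℝ A).comp (B.comp A)

/-- The metric trace `∑ gⁱʲ B(bᵢ, bⱼ)` of a bilinear map `B` with respect to a nondegenerate form
`G`, for a basis `b` of the space. Here `G.inverse : (E →L[ℝ] ℝ) →L[ℝ] E` is the musical isomorphism
`♯` (the inverse of `v ↦ G(v, ·)`), so that `G.inverse bⁱ = ∑ gⁱʲ bⱼ`, with `bⁱ` the dual basis.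
If `B` is bilinear, the value does not depend on the basis; it equals `∑ B(eᵢ, eᵢ)` for every
`G`-orthonormal basis `e` when `G` is an inner product. -/
def metricTrace [FiniteDimensional ℝ E] (G : E →L[ℝ] E →L[ℝ] ℝ) (B : E → E → F) : F :=
  ∑ i, B (Module.finBasis ℝ E i)
    (G.inverse (LinearMap.toContinuousLinearMap ((Module.finBasis ℝ E).coord i)))

/-- The form `(u, v, w) ↦ D_u G(v, w) + D_v G(u, w) - D_w G(u, v)` of constant fields
`u, v, w`. -/
def koszulForm (G : E → E →L[ℝ] E →L[ℝ] ℝ) (ξ : E) : E →L[ℝ] E →L[ℝ] E →L[ℝ] ℝ :=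
  fderiv ℝ G ξ + (fderiv ℝ G ξ).flip
    - (ContinuousLinearMap.flipₗᵢ ℝ E E ℝ).toContinuousLinearEquiv.toContinuousLinearMap.comp
        (fderiv ℝ G ξ).flip

/-- The Christoffel symbols `Γ_ξ(u, v) = uⁱ vʲ Γᵏᵢⱼ(ξ) ∂ₖ` of the Levi-Civita connection of `G`:
`G_ξ(Γ_ξ(u, v), w) = ½ (D_u G(v, w) + D_v G(u, w) - D_w G(u, v))`. -/
def christoffel (G : E → E →L[ℝ] E →L[ℝ] ℝ) (ξ : E) : E →L[ℝ] E →L[ℝ] E :=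
  (1 / 2 : ℝ) • (ContinuousLinearMap.compL ℝ E (E →L[ℝ] ℝ) E (G ξ).inverse).comp (koszulForm G ξ)

/-- The curvature `R(u, v) w = ∇_u ∇_v w - ∇_v ∇_u w` of the Levi-Civita connection of `G`, for
constant (hence commuting) fields `u, v, w`. -/
def curvature (G : E → E →L[ℝ] E →L[ℝ] ℝ) (ξ u v w : E) : E :=
  fderiv ℝ (fun ζ => christoffel G ζ v w) ξ u - fderiv ℝ (fun ζ => christoffel G ζ u w) ξ v
    + christoffel G ξ u (christoffel G ξ v w) - christoffel G ξ v (christoffel G ξ u w)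

/-- The second fundamental form `∇dφ(u, v) = ∇^φ_u (dφ v) - dφ (∇_u v)` of a map `φ` between
coordinate domains, with metric `G` on the source and `K` on the target. -/
def secondFundamentalForm (G : E → E →L[ℝ] E →L[ℝ] ℝ) (K : F → F →L[ℝ] F →L[ℝ] ℝ)
    (φ : E → F) (ξ u v : E) : F :=
  fderiv ℝ (fun ζ => fderiv ℝ φ ζ v) ξ u
    + christoffel K (φ ξ) (fderiv ℝ φ ξ u) (fderiv ℝ φ ξ v)
    - fderiv ℝ φ ξ (christoffel G ξ u v)

/-- The pull-back connection `∇^φ_u V` on vector fields `V` along `φ`, for the Levi-Civita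
connection of the metric `K` of the target. -/
def covDerivAlong (K : F → F →L[ℝ] F →L[ℝ] ℝ) (φ : E → F) (V : E → F) (ξ u : E) : F :=
  fderiv ℝ V ξ u + christoffel K (φ ξ) (fderiv ℝ φ ξ u) (V ξ)

/-- The second covariant derivative `∇^φ_u ∇^φ_v V - ∇^φ_{∇_u v} V` of a vector field `V` along
`φ`. -/
def secondCovDerivAlong (G : E → E →L[ℝ] E →L[ℝ] ℝ) (K : F → F →L[ℝ] F →L[ℝ] ℝ)
    (φ : E → F) (V : E → F) (ξ u v : E) : F :=
  covDerivAlong K φ (fun ζ => covDerivAlong K φ V ζ v) ξ u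
    - covDerivAlong K φ V ξ (christoffel G ξ u v)

end Coordinates

/-! ## Riemannian geometry on manifolds (without boundary)

All tensors at a point `x` are computed in the preferred chart at `x`. In Mathlib the tangent space
`TangentSpace I x` is a copy of the model space `E`, a vector being identified with its components
in the preferred chart at `x`, so a vector of components at `x` is a tangent vector at `x`. -/

section Manifold

variable {E : Type*} [NormedAddCommGroup E] [NormedSpace ℝ E]
  {H : Type*} [TopologicalSpace H] (I : ModelWithCorners ℝ E H)
  (M : Type*) [TopologicalSpace M] [ChartedSpace H M]
  {F : Type*} [NormedAddCommGroup F] [NormedSpace ℝ F]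
  {H' : Type*} [TopologicalSpace H'] {J : ModelWithCorners ℝ F H'}
  {N : Type*} [TopologicalSpace N] [ChartedSpace H' N]

/-- Fields of bilinear forms on the tangent spaces of `M`. -/
abbrev BilinField := ∀ x : M, TangentSpace I x →L[ℝ] TangentSpace I x →L[ℝ] ℝ

variable {I M} [IsManifold I 1 M] [IsManifold J 1 N]

/-- The components of `g` in the preferred chart at `x₀`, as a function of the coordinates. -/
def metricInChart (g : BilinField I M) (x₀ : M) (ξ : E) : E →L[ℝ] E →L[ℝ] ℝ :=
  pullbackForm (g ((extChartAt I x₀).symm ξ))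
    ((trivializationAt E (TangentSpace I) x₀).symmL ℝ ((extChartAt I x₀).symm ξ))

/-- The components, in the preferred charts at `x₀` and `φ x₀`, of a vector field `V` along `φ`. -/
def alongInChart (φ : M → N) (V : ∀ x : M, TangentSpace J (φ x)) (x₀ : M) (ξ : E) : F :=
  (trivializationAt F (TangentSpace J) (φ x₀)).continuousLinearMapAt ℝ
    (φ ((extChartAt I x₀).symm ξ)) (V ((extChartAt I x₀).symm ξ))

/-- The Christoffel symbols at `x` of `g` in the preferred chart at `x`. -/
def christoffelAt (g : BilinField I M) (x : M) : E →L[ℝ] E →L[ℝ] E :=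
  christoffel (metricInChart g x) (extChartAt I x x)

/-- The Riemann curvature tensor `R(u, v) w` of `g` at `x`. -/
def curvatureAt (g : BilinField I M) (x : M) (u v w : TangentSpace I x) : TangentSpace I x :=
  curvature (E := E) (metricInChart g x) (extChartAt I x x) u v w

/-- `g` is flat: its Riemann curvature tensor vanishes identically. -/
def IsFlat (g : BilinField I M) : Prop :=
  ∀ (x : M) (u v w : TangentSpace I x), curvatureAt g x u v w = 0

/-- The gradient of a function: `g(grad f, v) = df(v)`. -/
def grad (g : BilinField I M) (f : M → ℝ) (x : M) : TangentSpace I x :=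
  (g x).inverse (mfderiv I 𝓘(ℝ, ℝ) f x : TangentSpace I x →L[ℝ] ℝ)

/-- The trace with respect to `g` of a bilinear map on the tangent space at `x`. -/
def traceAt [FiniteDimensional ℝ E] (g : BilinField I M) (x : M) (B : E → E → F) : F :=
  metricTrace (E := E) (g x) B

/-- The tension field `τ(φ) = Tr_g ∇dφ` of `φ : (M, g) → (N, h)`. -/
def tensionField [FiniteDimensional ℝ E] (g : BilinField I M) (h : BilinField J N) (φ : M → N)
    (x : M) : TangentSpace J (φ x) :=
  traceAt (F := F) g x (secondFundamentalForm (metricInChart g x) (metricInChart h (φ x))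
    (writtenInExtChartAt I J x φ) (extChartAt I x x))

/-- `Tr_g (∇^φ ∇^φ V - ∇^φ_∇ V)` for a vector field `V` along `φ : (M, g) → (N, h)`. -/
def traceSecondCovDeriv [FiniteDimensional ℝ E] (g : BilinField I M) (h : BilinField J N)
    (φ : M → N) (V : ∀ x : M, TangentSpace J (φ x)) (x : M) : TangentSpace J (φ x) :=
  traceAt (F := F) g x (secondCovDerivAlong (metricInChart g x) (metricInChart h (φ x))
    (writtenInExtChartAt I J x φ) (alongInChart (I := I) φ V x) (extChartAt I x x))

/-- `Tr_g R^N(V, dφ) dφ` for a vector field `V` along `φ : (M, g) → (N, h)`. -/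
def traceCurvature [FiniteDimensional ℝ E] (g : BilinField I M) (h : BilinField J N)
    (φ : M → N) (V : ∀ x : M, TangentSpace J (φ x)) (x : M) : TangentSpace J (φ x) :=
  traceAt (F := F) g x
    (fun u v => curvatureAt h (φ x) (V x) (mfderiv I J φ x u) (mfderiv I J φ x v))

/-- The Jacobi operator along `φ : (M, g) → (N, h)`:
`J_φ(V) = - Tr_g R^N(V, dφ) dφ - Tr_g (∇^φ ∇^φ V - ∇^φ_∇ V)`. -/
def jacobiOperator [FiniteDimensional ℝ E] (g : BilinField I M) (h : BilinField J N)
    (φ : M → N) (V : ∀ x : M, TangentSpace J (φ x)) (x : M) : TangentSpace J (φ x) :=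
  - traceCurvature g h φ V x - traceSecondCovDeriv g h φ V x

/-- The bitension field `τ₂(φ) = J_φ(τ(φ))` of `φ : (M, g) → (N, h)`. -/
def bitensionField [FiniteDimensional ℝ E] (g : BilinField I M) (h : BilinField J N) (φ : M → N)
    (x : M) : TangentSpace J (φ x) :=
  jacobiOperator g h φ (tensionField g h φ) x

/-- `Tr_g ∇² X` for a vector field `X` on `(M, g)`. -/
def traceHessianField [FiniteDimensional ℝ E] (g : BilinField I M)
    (X : ∀ x : M, TangentSpace I x) (x : M) : TangentSpace I x :=
  traceSecondCovDeriv g g (id : M → M) X x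

end Manifold

/-! ## Lifts and metrics on the tangent bundle

The preferred chart of `TM` at `p = (x, u)` is the one induced by the preferred chart of `M` at `x`,
with coordinates `(xⁱ, yⁱ)`, so tangent vectors `aⁱ ∂/∂xⁱ + bⁱ ∂/∂yⁱ` of `TM` at `p` are pairs
`(a, b)` in `E × E`. -/

section TangentBundle

variable {E : Type*} [NormedAddCommGroup E] [NormedSpace ℝ E]
  {H : Type*} [TopologicalSpace H] {I : ModelWithCorners ℝ E H}
  {M : Type*} [TopologicalSpace M] [ChartedSpace H M] [IsManifold I ∞ M]

/-- The vertical lift `X^V = Xⁱ ∂/∂yⁱ` at `p` of a tangent vector at the base point of `p`. -/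
def verticalLift (p : TangentBundle I M) (X : TangentSpace I p.proj) : TangentSpace I.tangent p :=
  ((0, X) : E × E)

/-- The horizontal lift `X^H = Xⁱ (∂/∂xⁱ - uʲ Γᵏᵢⱼ ∂/∂yᵏ)` at `p = (x, u)` of a tangent vector
at `x`, where `Γ` are the Christoffel symbols of `g`. -/
def horizontalLift (g : BilinField I M) (p : TangentBundle I M) (X : TangentSpace I p.proj) :
    TangentSpace I.tangent p :=
  ((X, - christoffelAt g p.proj X p.snd) : E × E)

/-- The map sending `X^H + Y^V` to `X` (the differential of the projection `TM → M`). -/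
def horizontalPart (p : TangentBundle I M) :
    TangentSpace I.tangent p →L[ℝ] TangentSpace I p.proj :=
  ContinuousLinearMap.fst ℝ E E

/-- The connection map of `g`, sending `X^H + Y^V` to `Y`. -/
def verticalPart (g : BilinField I M) (p : TangentBundle I M) :
    TangentSpace I.tangent p →L[ℝ] TangentSpace I p.proj :=
  (ContinuousLinearMap.snd ℝ E E
    + ((christoffelAt g p.proj).flip p.snd).comp (ContinuousLinearMap.fst ℝ E E) : E × E →L[ℝ] E)

/-- The Mus-Sasaki metric on `TM`, for a function `f` on `M`: at `(x, u)`,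
`(X^H, Y^H) ↦ g(X, Y)`, `(X^H, Y^V) ↦ 0`, `(X^V, Y^V) ↦ f(x) g(X, Y)`. -/
def musSasaki (g : BilinField I M) (f : M → ℝ) : BilinField I.tangent (TangentBundle I M) :=
  fun p => pullbackForm (g p.proj) (horizontalPart p)
    + f p.proj • pullbackForm (g p.proj) (verticalPart g p)

/-- The Sasaki metric on `TM`: at `(x, u)`,
`(X^H, Y^H) ↦ g(X, Y)`, `(X^H, Y^V) ↦ 0`, `(X^V, Y^V) ↦ g(X, Y)`. -/
def sasaki (g : BilinField I M) : BilinField I.tangent (TangentBundle I M) :=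
  fun p => pullbackForm (g p.proj) (horizontalPart p)
    + pullbackForm (g p.proj) (verticalPart g p)

end TangentBundle

end RiemGeom

end

noncomputable section

namespace RiemGeom

open Set Filter
open scoped Topology

section Calculus

variable {E : Type*} [NormedAddCommGroup E] [NormedSpace ℝ E]
  {F : Type*} [NormedAddCommGroup F] [NormedSpace ℝ F]
  {F' : Type*} [NormedAddCommGroup F'] [NormedSpace ℝ F']
  {F'' : Type*} [NormedAddCommGroup F''] [NormedSpace ℝ F'']

lemma fderiv_bilinear_apply {B : E → F →L[ℝ] F' →L[ℝ] F''} {X : E → F} {Y : E → F'} {ξ : E}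
    (hB : DifferentiableAt ℝ B ξ) (hX : DifferentiableAt ℝ X ξ) (hY : DifferentiableAt ℝ Y ξ)
    (u : E) :
    fderiv ℝ (fun ζ => B ζ (X ζ) (Y ζ)) ξ u
      = fderiv ℝ B ξ u (X ξ) (Y ξ) + B ξ (fderiv ℝ X ξ u) (Y ξ) + B ξ (X ξ) (fderiv ℝ Y ξ u) := by
  have h := ((hB.hasFDerivAt.clm_apply hX.hasFDerivAt).clm_apply hY.hasFDerivAt).fderiv
  rw [h]
  simp
  abel

lemma fderiv_linear_apply {A : E → F →L[ℝ] F'} {X : E → F} {ξ : E}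
    (hA : DifferentiableAt ℝ A ξ) (hX : DifferentiableAt ℝ X ξ) (u : E) :
    fderiv ℝ (fun ζ => A ζ (X ζ)) ξ u = fderiv ℝ A ξ u (X ξ) + A ξ (fderiv ℝ X ξ u) := by
  rw [(hA.hasFDerivAt.clm_apply hX.hasFDerivAt).fderiv]
  simp
  abel

lemma fderiv_fderiv_const_apply {V : E → F} {ξ : E} (hV : ContDiffAt ℝ 2 V ξ) (u v : E) :
    fderiv ℝ (fun ζ => fderiv ℝ V ζ v) ξ u = fderiv ℝ (fderiv ℝ V) ξ u v := by
  have h : DifferentiableAt ℝ (fderiv ℝ V) ξ :=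
    (hV.fderiv_right (m := 1) (by norm_num)).differentiableAt (by norm_num)
  simpa using fderiv_linear_apply h (differentiableAt_const v) u

lemma fderiv_fderiv_symm {V : E → F} {ξ : E} (hV : ContDiffAt ℝ 2 V ξ) (u v : E) :
    fderiv ℝ (fderiv ℝ V) ξ u v = fderiv ℝ (fderiv ℝ V) ξ v u :=
  (hV.isSymmSndFDerivAt (by simp)) u v

end Calculus

section Metric

variable {E : Type*} [NormedAddCommGroup E] [NormedSpace ℝ E]

/-- `G` is a smooth Riemannian metric on the open set `U` of the coordinate space. -/
structure IsMetricOn (G : E → E →L[ℝ] E →L[ℝ] ℝ) (U : Set E) : Prop where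
  isOpen : IsOpen U
  contDiffOn : ContDiffOn ℝ ∞ G U
  symm : ∀ ξ ∈ U, ∀ u v, G ξ u v = G ξ v u
  pos : ∀ ξ ∈ U, ∀ v, v ≠ 0 → 0 < G ξ v v

lemma isInvertible_of_pos [FiniteDimensional ℝ E] {B : E →L[ℝ] E →L[ℝ] ℝ}
    (hB : ∀ v, v ≠ 0 → 0 < B v v) : B.IsInvertible := by
  have hinj : Function.Injective B.toLinearMap := by
    rw [← LinearMap.ker_eq_bot, LinearMap.ker_eq_bot']
    intro v hv
    by_contra hne
    have := hB v hne
    simp only [ContinuousLinearMap.coe_coe] at hv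
    simp [hv] at this
  have hfin : Module.finrank ℝ E = Module.finrank ℝ (E →L[ℝ] ℝ) := by
    rw [← (LinearMap.toContinuousLinearMap (𝕜 := ℝ) (E := E) (F' := ℝ)).finrank_eq]
    exact (Subspace.dual_finrank_eq (K := ℝ) (V := E)).symm
  refine ⟨(LinearEquiv.ofInjectiveOfFinrankEq B.toLinearMap hinj hfin).toContinuousLinearEquiv, ?_⟩
  ext v w
  rfl

namespace IsMetricOn

variable {G : E → E →L[ℝ] E →L[ℝ] ℝ} {U : Set E} {ξ : E}

lemma contDiffAt (h : IsMetricOn G U) (hξ : ξ ∈ U) : ContDiffAt ℝ ∞ G ξ :=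
  h.contDiffOn.contDiffAt (h.isOpen.mem_nhds hξ)

lemma differentiableAt (h : IsMetricOn G U) (hξ : ξ ∈ U) : DifferentiableAt ℝ G ξ :=
  (h.contDiffAt hξ).differentiableAt (by simp)

lemma fderiv_symm (h : IsMetricOn G U) (hξ : ξ ∈ U) (u v w : E) :
    fderiv ℝ G ξ u v w = fderiv ℝ G ξ u w v := by
  have hd := h.differentiableAt hξ
  have h1 := fderiv_bilinear_apply hd (differentiableAt_const v) (differentiableAt_const w) u
  have h2 := fderiv_bilinear_apply hd (differentiableAt_const w) (differentiableAt_const v) u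
  have he : (fun ζ => G ζ v w) =ᶠ[𝓝 ξ] fun ζ => G ζ w v :=
    Filter.eventually_of_mem (h.isOpen.mem_nhds hξ) fun ζ hζ => h.symm ζ hζ v w
  rw [he.fderiv_eq] at h1
  simp at h1 h2
  rw [← h1, h2]

lemma contDiffAt_koszulForm (h : IsMetricOn G U) (hξ : ξ ∈ U) :
    ContDiffAt ℝ ∞ (koszulForm G) ξ := by
  have h1 : ContDiffAt ℝ ∞ (fderiv ℝ G) ξ := (h.contDiffAt hξ).fderiv_right (by simp)
  have h2 : ContDiffAt ℝ ∞ (fun ζ => (fderiv ℝ G ζ).flip) ξ :=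
    (ContinuousLinearMap.flipₗᵢ ℝ E E (E →L[ℝ] ℝ)).contDiff.contDiffAt.comp ξ h1
  unfold koszulForm
  exact (h1.add h2).sub (contDiffAt_const.clm_comp h2)

variable [FiniteDimensional ℝ E]

lemma isInvertible (h : IsMetricOn G U) (hξ : ξ ∈ U) : (G ξ).IsInvertible :=
  isInvertible_of_pos (h.pos ξ hξ)

lemma eq_of_forall (h : IsMetricOn G U) (hξ : ξ ∈ U) {v w : E} (hvw : ∀ z, G ξ v z = G ξ w z) :
    v = w :=
  (h.isInvertible hξ).injective (by ext z; exact hvw z)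

lemma apply_inverse (h : IsMetricOn G U) (hξ : ξ ∈ U) (l : E →L[ℝ] ℝ) (v : E) :
    G ξ ((G ξ).inverse l) v = l v := by
  rw [(h.isInvertible hξ).self_apply_inverse]

lemma contDiffAt_inverse (h : IsMetricOn G U) (hξ : ξ ∈ U) :
    ContDiffAt ℝ ∞ (fun ζ => (G ζ).inverse) ξ :=
  ((h.isInvertible hξ).contDiffAt_map_inverse).comp ξ (h.contDiffAt hξ)

lemma contDiffAt_christoffel (h : IsMetricOn G U) (hξ : ξ ∈ U) :
    ContDiffAt ℝ ∞ (christoffel G) ξ := by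
  unfold christoffel
  have h1 : ContDiffAt ℝ ∞
      (fun ζ => ContinuousLinearMap.compL ℝ E (E →L[ℝ] ℝ) E (G ζ).inverse) ξ :=
    (ContinuousLinearMap.compL ℝ E (E →L[ℝ] ℝ) E).contDiff.contDiffAt.comp ξ
      (h.contDiffAt_inverse hξ)
  exact (h1.clm_comp (h.contDiffAt_koszulForm hξ)).const_smul _

lemma differentiableAt_christoffel (h : IsMetricOn G U) (hξ : ξ ∈ U) :
    DifferentiableAt ℝ (christoffel G) ξ :=
  (h.contDiffAt_christoffel hξ).differentiableAt (by simp)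

lemma apply_christoffel (h : IsMetricOn G U) (hξ : ξ ∈ U) (u v w : E) :
    G ξ (christoffel G ξ u v) w
      = (fderiv ℝ G ξ u v w + fderiv ℝ G ξ v u w - fderiv ℝ G ξ w u v) / 2 := by
  have h1 : christoffel G ξ u v = (1 / 2 : ℝ) • (G ξ).inverse (koszulForm G ξ u v) := rfl
  rw [h1, map_smul, smul_apply, h.apply_inverse hξ]
  have h2 : koszulForm G ξ u v w
    = fderiv ℝ G ξ u v w + fderiv ℝ G ξ v u w - fderiv ℝ G ξ w u v := rfl
  rw [h2, smul_eq_mul]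
  ring

lemma christoffel_symm (h : IsMetricOn G U) (hξ : ξ ∈ U) (u v : E) :
    christoffel G ξ u v = christoffel G ξ v u := by
  refine h.eq_of_forall hξ fun w => ?_
  rw [h.apply_christoffel hξ, h.apply_christoffel hξ, h.fderiv_symm hξ w u v]
  ring

lemma christoffel_metric (h : IsMetricOn G U) (hξ : ξ ∈ U) (u v w : E) :
    fderiv ℝ G ξ u v w
      = G ξ (christoffel G ξ u v) w + G ξ v (christoffel G ξ u w) := by
  rw [h.symm ξ hξ v, h.apply_christoffel hξ, h.apply_christoffel hξ, h.fderiv_symm hξ u w v,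
    h.fderiv_symm hξ v u w, h.fderiv_symm hξ w u v]
  ring

/-- The Levi-Civita connection is the only torsion-free metric connection. -/
lemma eq_christoffel (h : IsMetricOn G U) (hξ : ξ ∈ U) {T : E → E → E}
    (hsymm : ∀ u v, T u v = T v u)
    (hmetric : ∀ u v w, fderiv ℝ G ξ u v w = G ξ (T u v) w + G ξ v (T u w)) (u v : E) :
    T u v = christoffel G ξ u v := by
  refine h.eq_of_forall hξ fun w => ?_
  rw [h.apply_christoffel hξ, hmetric, hmetric, hmetric, hsymm v u, hsymm w u, hsymm w v,
    h.symm ξ hξ v, h.symm ξ hξ u]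
  ring

end IsMetricOn

end Metric

section CovDeriv

variable {E : Type*} [NormedAddCommGroup E] [NormedSpace ℝ E]
  {F : Type*} [NormedAddCommGroup F] [NormedSpace ℝ F]
  {F' : Type*} [NormedAddCommGroup F'] [NormedSpace ℝ F']
  {K : F → F →L[ℝ] F →L[ℝ] ℝ} {φ : E → F} {ξ : E}

lemma covDerivAlong_congr {φ' V V' : E → F} (hφ : φ =ᶠ[𝓝 ξ] φ') (hV : V =ᶠ[𝓝 ξ] V') (u : E) :
    covDerivAlong K φ V ξ u = covDerivAlong K φ' V' ξ u := by
  simp only [covDerivAlong, hφ.fderiv_eq, hV.fderiv_eq, hφ.eq_of_nhds, hV.eq_of_nhds]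

lemma covDerivAlong_add {V W : E → F} (hV : DifferentiableAt ℝ V ξ) (hW : DifferentiableAt ℝ W ξ)
    (u : E) : covDerivAlong K φ (fun ζ => V ζ + W ζ) ξ u
      = covDerivAlong K φ V ξ u + covDerivAlong K φ W ξ u := by
  simp only [covDerivAlong, fderiv_fun_add hV hW, map_add, add_apply]
  abel

lemma covDerivAlong_sub {V W : E → F} (hV : DifferentiableAt ℝ V ξ) (hW : DifferentiableAt ℝ W ξ)
    (u : E) : covDerivAlong K φ (fun ζ => V ζ - W ζ) ξ u
      = covDerivAlong K φ V ξ u - covDerivAlong K φ W ξ u := by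
  simp only [covDerivAlong, fderiv_fun_sub hV hW, map_sub, sub_apply]
  abel

lemma covDerivAlong_smul {k : E → ℝ} {V : E → F} (hk : DifferentiableAt ℝ k ξ)
    (hV : DifferentiableAt ℝ V ξ) (u : E) : covDerivAlong K φ (fun ζ => k ζ • V ζ) ξ u
      = fderiv ℝ k ξ u • V ξ + k ξ • covDerivAlong K φ V ξ u := by
  simp only [covDerivAlong, fderiv_fun_smul hk hV, map_smul, add_apply,
    smul_apply, ContinuousLinearMap.smulRight_apply, smul_add]
  abel

lemma covDerivAlong_comp {ψ : F' → E} {V : E → F} {ζ : F'} (hψ : DifferentiableAt ℝ ψ ζ)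
    (hφ : DifferentiableAt ℝ φ (ψ ζ)) (hV : DifferentiableAt ℝ V (ψ ζ)) (u : F') :
    covDerivAlong K (fun η => φ (ψ η)) (fun η => V (ψ η)) ζ u
      = covDerivAlong K φ V (ψ ζ) (fderiv ℝ ψ ζ u) := by
  have h1 := fderiv_comp ζ hφ hψ
  have h2 := fderiv_comp ζ hV hψ
  simp only [Function.comp_def] at h1 h2
  simp only [covDerivAlong, h1, h2, ContinuousLinearMap.comp_apply]

lemma covDerivAlong_add_right {V : E → F} (u v : E) :
    covDerivAlong K φ V ξ (u + v) = covDerivAlong K φ V ξ u + covDerivAlong K φ V ξ v := by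
  simp only [covDerivAlong, map_add, add_apply]
  abel

lemma covDerivAlong_smul_right {V : E → F} (c : ℝ) (u : E) :
    covDerivAlong K φ V ξ (c • u) = c • covDerivAlong K φ V ξ u := by
  simp only [covDerivAlong, map_smul, smul_apply, smul_add]

lemma differentiableAt_covDerivAlong {V : E → F} (hK : DifferentiableAt ℝ (christoffel K) (φ ξ))
    (hφ : ContDiffAt ℝ 2 φ ξ) (hV : ContDiffAt ℝ 2 V ξ) (v : E) :
    DifferentiableAt ℝ (fun ζ => covDerivAlong K φ V ζ v) ξ := by
  have h1 : DifferentiableAt ℝ (fderiv ℝ φ) ξ :=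
    (hφ.fderiv_right (m := 1) (by norm_num)).differentiableAt (by norm_num)
  have h2 : DifferentiableAt ℝ (fderiv ℝ V) ξ :=
    (hV.fderiv_right (m := 1) (by norm_num)).differentiableAt (by norm_num)
  have h3 : DifferentiableAt ℝ φ ξ := hφ.differentiableAt (by norm_num)
  have h4 : DifferentiableAt ℝ V ξ := hV.differentiableAt (by norm_num)
  have h5 : DifferentiableAt ℝ (fun ζ => christoffel K (φ ζ)) ξ := hK.comp ξ h3
  unfold covDerivAlong
  fun_prop

lemma contDiffAt_covDerivAlong {V : E → F} (hK : ContDiffAt ℝ ∞ (christoffel K) (φ ξ))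
    (hφ : ContDiffAt ℝ ∞ φ ξ) (hV : ContDiffAt ℝ ∞ V ξ) (v : E) :
    ContDiffAt ℝ ∞ (fun ζ => covDerivAlong K φ V ζ v) ξ := by
  have h1 : ContDiffAt ℝ ∞ (fderiv ℝ φ) ξ := hφ.fderiv_right (by simp)
  have h2 : ContDiffAt ℝ ∞ (fderiv ℝ V) ξ := hV.fderiv_right (by simp)
  have h5 : ContDiffAt ℝ ∞ (fun ζ => christoffel K (φ ζ)) ξ := hK.comp ξ hφ
  unfold covDerivAlong
  fun_prop

lemma fderiv_christoffel_apply {x : F} (hK : DifferentiableAt ℝ (christoffel K) x) (u v w : F) :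
    fderiv ℝ (fun ζ => christoffel K ζ v w) x u
      = fderiv ℝ (christoffel K) x u v w := by
  simpa using fderiv_bilinear_apply hK (differentiableAt_const v) (differentiableAt_const w) u

/-- The curvature of a pull-back connection. -/
lemma covDerivAlong_commutator {V : E → F} (hK : DifferentiableAt ℝ (christoffel K) (φ ξ))
    (hφ : ContDiffAt ℝ 2 φ ξ) (hV : ContDiffAt ℝ 2 V ξ) (u v : E) :
    covDerivAlong K φ (fun ζ => covDerivAlong K φ V ζ v) ξ u
      - covDerivAlong K φ (fun ζ => covDerivAlong K φ V ζ u) ξ v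
      = curvature K (φ ξ) (fderiv ℝ φ ξ u) (fderiv ℝ φ ξ v) (V ξ) := by
  have h1 : DifferentiableAt ℝ (fderiv ℝ φ) ξ :=
    (hφ.fderiv_right (m := 1) (by norm_num)).differentiableAt (by norm_num)
  have h2 : DifferentiableAt ℝ (fderiv ℝ V) ξ :=
    (hV.fderiv_right (m := 1) (by norm_num)).differentiableAt (by norm_num)
  have h3 : DifferentiableAt ℝ φ ξ := hφ.differentiableAt (by norm_num)
  have h4 : DifferentiableAt ℝ V ξ := hV.differentiableAt (by norm_num)
  have h5 : DifferentiableAt ℝ (fun ζ => christoffel K (φ ζ)) ξ := hK.comp ξ h3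
  have h6 : ∀ u : E, fderiv ℝ (fun ζ => christoffel K (φ ζ)) ξ u
      = fderiv ℝ (christoffel K) (φ ξ) (fderiv ℝ φ ξ u) := fun u => by
    have := fderiv_comp ξ hK h3
    simp only [Function.comp_def] at this
    rw [this, ContinuousLinearMap.comp_apply]
  have key : ∀ u v : E, covDerivAlong K φ (fun ζ => covDerivAlong K φ V ζ v) ξ u
      = fderiv ℝ (fderiv ℝ V) ξ u v
        + (fderiv ℝ (christoffel K) (φ ξ) (fderiv ℝ φ ξ u) (fderiv ℝ φ ξ v) (V ξ)
          + christoffel K (φ ξ) (fderiv ℝ (fderiv ℝ φ) ξ u v) (V ξ)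
          + christoffel K (φ ξ) (fderiv ℝ φ ξ v) (fderiv ℝ V ξ u))
        + (christoffel K (φ ξ) (fderiv ℝ φ ξ u) (fderiv ℝ V ξ v)
          + christoffel K (φ ξ) (fderiv ℝ φ ξ u)
              (christoffel K (φ ξ) (fderiv ℝ φ ξ v) (V ξ))) := by
    intro u v
    have h7 : DifferentiableAt ℝ (fun ζ => fderiv ℝ φ ζ v) ξ := by fun_prop
    have h8 : DifferentiableAt ℝ (fun ζ => fderiv ℝ V ζ v) ξ := by fun_prop
    have h9 := fderiv_bilinear_apply h5 h7 h4 u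
    have h10 : DifferentiableAt ℝ
      (fun ζ => christoffel K (φ ζ) (fderiv ℝ φ ζ v) (V ζ)) ξ := by fun_prop
    rw [h6, fderiv_fderiv_const_apply hφ] at h9
    conv_lhs => unfold covDerivAlong
    rw [fderiv_fun_add h8 h10, add_apply, h9, fderiv_fderiv_const_apply hV,
      map_add]
  rw [key u v, key v u, fderiv_fderiv_symm hV v u, fderiv_fderiv_symm hφ v u, curvature,
    fderiv_christoffel_apply hK, fderiv_christoffel_apply hK]
  abel

lemma covDerivAlong_fderiv_symm {U : Set F} (hK : IsMetricOn K U) [FiniteDimensional ℝ F]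
    (hξ : φ ξ ∈ U) (hφ : ContDiffAt ℝ 2 φ ξ) (u v : E) :
    covDerivAlong K φ (fun ζ => fderiv ℝ φ ζ v) ξ u
      = covDerivAlong K φ (fun ζ => fderiv ℝ φ ζ u) ξ v := by
  simp only [covDerivAlong]
  rw [fderiv_fderiv_const_apply hφ, fderiv_fderiv_const_apply hφ, fderiv_fderiv_symm hφ,
    hK.christoffel_symm hξ]

/-- Pull-back connections are metric. -/
lemma fderiv_metric_apply {U : Set F} (hK : IsMetricOn K U) [FiniteDimensional ℝ F]
    (hξ : φ ξ ∈ U) {V W : E → F} (hφ : DifferentiableAt ℝ φ ξ) (hV : DifferentiableAt ℝ V ξ)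
    (hW : DifferentiableAt ℝ W ξ) (u : E) :
    fderiv ℝ (fun ζ => K (φ ζ) (V ζ) (W ζ)) ξ u
      = K (φ ξ) (covDerivAlong K φ V ξ u) (W ξ) + K (φ ξ) (V ξ) (covDerivAlong K φ W ξ u) := by
  have hd := hK.differentiableAt hξ
  have h1 := fderiv_bilinear_apply (B := fun ζ => K (φ ζ)) (hd.comp ξ hφ) hV hW u
  have h2 := fderiv_comp ξ hd hφ
  simp only [Function.comp_def] at h2
  rw [h1, h2, ContinuousLinearMap.comp_apply, hK.christoffel_metric hξ]
  simp only [covDerivAlong, map_add, add_apply]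
  abel

end CovDeriv

section Trace

lemma exists_orthonormal_basis_bilinear {V : Type*} [AddCommGroup V] [Module ℝ V]
    [FiniteDimensional ℝ V] {B : V →ₗ[ℝ] V →ₗ[ℝ] ℝ} (hsymm : ∀ u v, B u v = B v u)
    (hpos : ∀ v, v ≠ 0 → 0 < B v v) :
    ∃ e : Module.Basis (Fin (Module.finrank ℝ V)) ℝ V,
      ∀ i j, B (e i) (e j) = if i = j then 1 else 0 := by
  let core : InnerProductSpace.Core ℝ V :=
    { inner := fun u v => B u v
      conj_inner_symm := fun u v => by simp [hsymm u v]
      re_inner_nonneg := fun v => by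
        by_cases hv : v = 0
        · simp [hv]
        · simpa using (hpos v hv).le
      add_left := fun u v w => by simp
      smul_left := fun u v r => by simp
      definite := fun v hv => by
        by_contra hne
        exact (hpos v hne).ne' hv }
  let _ : NormedAddCommGroup V := core.toNormedAddCommGroup
  let _ : InnerProductSpace ℝ V := InnerProductSpace.ofCore core.toCore
  refine ⟨(stdOrthonormalBasis ℝ V).toBasis, fun i j => ?_⟩
  have := orthonormal_iff_ite.1 (stdOrthonormalBasis ℝ V).orthonormal i j
  rw [OrthonormalBasis.coe_toBasis]
  exact this

variable {E : Type*} [NormedAddCommGroup E] [NormedSpace ℝ E] [FiniteDimensional ℝ E]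
  {F : Type*} [NormedAddCommGroup F] [NormedSpace ℝ F]

lemma exists_orthonormal_basis {G : E →L[ℝ] E →L[ℝ] ℝ} (hsymm : ∀ u v, G u v = G v u)
    (hpos : ∀ v, v ≠ 0 → 0 < G v v) :
    ∃ e : Module.Basis (Fin (Module.finrank ℝ E)) ℝ E,
      ∀ i j, G (e i) (e j) = if i = j then 1 else 0 :=
  exists_orthonormal_basis_bilinear (B := G.toLinearMap₁₂) hsymm hpos

lemma metricTrace_eq_sum {ι : Type*} [Fintype ι] [DecidableEq ι] {G : E →L[ℝ] E →L[ℝ] ℝ}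
    (hG : G.IsInvertible) (e : Module.Basis ι ℝ E)
    (he : ∀ i j, G (e i) (e j) = if i = j then 1 else 0) {B : E → E → F}
    (hadd : ∀ u v w, B (u + v) w = B u w + B v w) (hsmul : ∀ (c : ℝ) u w, B (c • u) w = c • B u w)
    (hadd' : ∀ u v w, B u (v + w) = B u v + B u w)
    (hsmul' : ∀ (c : ℝ) u w, B u (c • w) = c • B u w) :
    metricTrace G B = ∑ i, B (e i) (e i) := by
  set b := Module.finBasis ℝ E
  let B' : E →ₗ[ℝ] E →ₗ[ℝ] F := LinearMap.mk₂ ℝ B hadd hsmul hadd' hsmul'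
  have hB' : ∀ u v, B u v = B' u v := fun _ _ => rfl
  have hinv : ∀ i, G.inverse (LinearMap.toContinuousLinearMap (b.coord i))
      = ∑ j, b.repr (e j) i • e j := by
    intro i
    have : LinearMap.toContinuousLinearMap (b.coord i) = G (∑ j, b.repr (e j) i • e j) := by
      apply ContinuousLinearMap.coe_injective
      refine e.ext fun k => ?_
      simp [map_sum, he]
    rw [this, hG.inverse_apply_self]
  simp only [metricTrace, hB']
  calc ∑ i, B' (b i) (G.inverse (LinearMap.toContinuousLinearMap (b.coord i)))
      = ∑ i, ∑ j, B' (b.repr (e j) i • b i) (e j) := by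
        refine Finset.sum_congr rfl fun i _ => ?_
        rw [hinv, map_sum]
        simp
    _ = ∑ j, B' (e j) (e j) := by
        rw [Finset.sum_comm]
        refine Finset.sum_congr rfl fun j _ => ?_
        rw [← LinearMap.sum_apply, ← map_sum, b.sum_repr]

end Trace

section SasakiCoordinates

variable {E : Type*} [NormedAddCommGroup E] [NormedSpace ℝ E]

/-- The connection map of `G` in the coordinates `(xⁱ, yⁱ)` of the tangent bundle. -/
def connectionMap (G : E → E →L[ℝ] E →L[ℝ] ℝ) (z : E × E) : E × E →L[ℝ] E :=
  ContinuousLinearMap.snd ℝ E E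
    + ((christoffel G z.1).flip z.2).comp (ContinuousLinearMap.fst ℝ E E)

/-- The metric `(X^H, Y^H) ↦ G(X, Y)`, `(X^H, Y^V) ↦ 0`, `(X^V, Y^V) ↦ f G(X, Y)` in the
coordinates `(xⁱ, yⁱ)` of the tangent bundle. -/
def warpedForm (G : E → E →L[ℝ] E →L[ℝ] ℝ) (f : E → ℝ) (z : E × E) :
    E × E →L[ℝ] E × E →L[ℝ] ℝ :=
  pullbackForm (G z.1) (ContinuousLinearMap.fst ℝ E E)
    + f z.1 • pullbackForm (G z.1) (connectionMap G z)

/-- The gradient of `f` in coordinates. -/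
def gradIn (G : E → E →L[ℝ] E →L[ℝ] ℝ) (f : E → ℝ) (ξ : E) : E :=
  (G ξ).inverse (fderiv ℝ f ξ)

/-- `½ log f`. -/
def halfLog (f : E → ℝ) (ξ : E) : ℝ := (1 / 2) * Real.log (f ξ)

/-- The horizontal lift in the coordinates `(xⁱ, yⁱ)` of the tangent bundle. -/
def horizontalIn (G : E → E →L[ℝ] E →L[ℝ] ℝ) (z : E × E) (a : E) : E × E :=
  (a, -christoffel G z.1 a z.2)

/-- `G` is a smooth flat Riemannian metric and `f` a smooth positive function on the open set
`U`. -/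
structure IsFlatWarpingOn (G : E → E →L[ℝ] E →L[ℝ] ℝ) (f : E → ℝ) (U : Set E) : Prop
    extends IsMetricOn G U where
  flat : ∀ ξ ∈ U, ∀ u v w, curvature G ξ u v w = 0
  contDiffOn_warp : ContDiffOn ℝ ∞ f U
  warp_pos : ∀ ξ ∈ U, 0 < f ξ

variable {G : E → E →L[ℝ] E →L[ℝ] ℝ} {f : E → ℝ} {U : Set E} {z : E × E}

lemma connectionMap_apply (v : E × E) :
    connectionMap G z v = v.2 + christoffel G z.1 v.1 z.2 := rfl

lemma connectionMap_horizontalIn (a : E) : connectionMap G z (horizontalIn G z a) = 0 := by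
  simp [connectionMap_apply, horizontalIn]

lemma eq_horizontalIn {v : E × E} (hv : connectionMap G z v = 0) :
    v = horizontalIn G z v.1 := by
  rw [connectionMap_apply, add_eq_zero_iff_eq_neg] at hv
  exact Prod.ext rfl hv

lemma horizontalIn_smul (c : ℝ) (a : E) : horizontalIn G z (c • a) = c • horizontalIn G z a := by
  simp [horizontalIn]

lemma prod_eq_of_connectionMap {v w : E × E} (h1 : v.1 = w.1)
    (h2 : connectionMap G z v = connectionMap G z w) : v = w := by
  refine Prod.ext h1 ?_
  rw [connectionMap_apply, connectionMap_apply, h1] at h2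
  exact add_right_cancel h2

lemma warpedForm_apply (v w : E × E) :
    warpedForm G f z v w = G z.1 v.1 w.1
      + f z.1 * G z.1 (connectionMap G z v) (connectionMap G z w) := rfl

lemma covDerivAlong_snd (v : E × E) :
    covDerivAlong G Prod.fst Prod.snd z v = connectionMap G z v := by
  simp [covDerivAlong, connectionMap_apply, fderiv_fst, fderiv_snd]

lemma covDerivAlong_const_fst (a : E) (u : E × E) :
    covDerivAlong G Prod.fst (fun _ => a) z u = christoffel G z.1 u.1 a := by
  simp [covDerivAlong, fderiv_fst]

lemma covDerivAlong_comp_fst {V : E → E} (hV : DifferentiableAt ℝ V z.1) (u : E × E) :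
    covDerivAlong G Prod.fst (fun ζ : E × E => V ζ.1) z u = covDerivAlong G id V z.1 u.1 := by
  have := covDerivAlong_comp (K := G) (φ := id) (ψ := (Prod.fst : E × E → E)) (V := V) (ζ := z)
    differentiableAt_fst differentiableAt_id hV u
  simpa [fderiv_fst] using this

lemma fderiv_halfLog {ξ : E} (hf : DifferentiableAt ℝ f ξ) (hpos : 0 < f ξ) (u : E) :
    fderiv ℝ f ξ u = 2 * f ξ * fderiv ℝ (halfLog f) ξ u := by
  have h1 : fderiv ℝ (halfLog f) ξ u = (1 / 2) * ((f ξ)⁻¹ * fderiv ℝ f ξ u) := by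
    unfold halfLog
    rw [((hf.hasFDerivAt.log hpos.ne').const_mul (1 / 2)).fderiv]
    simp
  have := hpos.ne'
  rw [h1]
  field_simp

namespace IsFlatWarpingOn

lemma contDiffAt_warp (h : IsFlatWarpingOn G f U) {ξ : E} (hξ : ξ ∈ U) : ContDiffAt ℝ ∞ f ξ :=
  h.contDiffOn_warp.contDiffAt (h.isOpen.mem_nhds hξ)

lemma contDiffAt_halfLog (h : IsFlatWarpingOn G f U) {ξ : E} (hξ : ξ ∈ U) :
    ContDiffAt ℝ ∞ (halfLog f) ξ :=
  contDiffAt_const.mul ((h.contDiffAt_warp hξ).log (h.warp_pos ξ hξ).ne')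

lemma const_one (h : IsFlatWarpingOn G f U) : IsFlatWarpingOn G (fun _ => 1) U where
  toIsMetricOn := h.toIsMetricOn
  flat := h.flat
  contDiffOn_warp := contDiffOn_const
  warp_pos := fun _ _ => one_pos

end IsFlatWarpingOn

variable [FiniteDimensional ℝ E]

lemma IsMetricOn.contDiffAt_connectionMap (h : IsMetricOn G U) (hz : z.1 ∈ U) :
    ContDiffAt ℝ ∞ (connectionMap G) z := by
  have h1 : ContDiffAt ℝ ∞ (fun ζ : E × E => christoffel G ζ.1) z :=
    (h.contDiffAt_christoffel hz).comp z contDiffAt_fst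
  have h2 : ContDiffAt ℝ ∞ (fun ζ : E × E => (christoffel G ζ.1).flip) z :=
    (ContinuousLinearMap.flipₗᵢ ℝ E E E).contDiff.contDiffAt.comp z h1
  exact contDiffAt_const.add ((h2.clm_apply contDiffAt_snd).clm_comp contDiffAt_const)

lemma IsMetricOn.isMetricOn_warpedForm (h : IsMetricOn G U) (hf : ContDiffOn ℝ ∞ f U)
    (hpos : ∀ ξ ∈ U, 0 < f ξ) : IsMetricOn (warpedForm G f) (U ×ˢ univ) where
  isOpen := h.isOpen.prod isOpen_univ
  contDiffOn := by
    rintro z ⟨hz, -⟩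
    refine ContDiffAt.contDiffWithinAt ?_
    have hG : ContDiffAt ℝ ∞ (fun ζ : E × E => G ζ.1) z := (h.contDiffAt hz).comp z contDiffAt_fst
    have hf : ContDiffAt ℝ ∞ (fun ζ : E × E => f ζ.1) z :=
      (hf.contDiffAt (h.isOpen.mem_nhds hz)).comp z contDiffAt_fst
    have hpull : ∀ {A : E × E → E × E →L[ℝ] E}, ContDiffAt ℝ ∞ A z →
        ContDiffAt ℝ ∞ (fun ζ => pullbackForm (G ζ.1) (A ζ)) z := by
      intro A hA
      have h1 : ContDiffAt ℝ ∞ (fun ζ => (ContinuousLinearMap.compL ℝ (E × E) E ℝ).flip (A ζ)) z :=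
        (ContinuousLinearMap.compL ℝ (E × E) E ℝ).flip.contDiff.contDiffAt.comp z hA
      exact h1.clm_comp (hG.clm_comp hA)
    exact (hpull contDiffAt_const).add (hf.smul (hpull (h.contDiffAt_connectionMap hz)))
  symm := by
    rintro z ⟨hz, -⟩ u v
    rw [warpedForm_apply, warpedForm_apply, h.symm _ hz u.1, h.symm _ hz (connectionMap G z u)]
  pos := by
    rintro z ⟨hz, -⟩ v hv
    rw [warpedForm_apply]
    have hnn : ∀ a, 0 ≤ G z.1 a a := fun a => by
      by_cases ha : a = 0
      · simp [ha]
      · exact (h.pos _ hz a ha).le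
    by_cases h1 : v.1 = 0
    · have h2 : connectionMap G z v ≠ 0 := fun h2 =>
        hv (prod_eq_of_connectionMap (G := G) (z := z) h1 (by rw [h2, map_zero]))
      have := mul_pos (hpos _ hz) (h.pos _ hz _ h2)
      have := hnn v.1
      linarith
    · have := mul_nonneg (hpos _ hz).le (hnn (connectionMap G z v))
      have := h.pos _ hz _ h1
      linarith

namespace IsMetricOn

lemma gradIn_apply (h : IsMetricOn G U) {ξ : E} (hξ : ξ ∈ U) (w : E) :
    G ξ (gradIn G f ξ) w = fderiv ℝ f ξ w := h.apply_inverse hξ _ _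

lemma contDiffAt_gradIn (h : IsMetricOn G U) (hf : ContDiffOn ℝ ∞ f U) {ξ : E} (hξ : ξ ∈ U) :
    ContDiffAt ℝ ∞ (gradIn G f) ξ :=
  (h.contDiffAt_inverse hξ).clm_apply
    ((hf.contDiffAt (h.isOpen.mem_nhds hξ)).fderiv_right (by simp))

/-- The Hessian of a function is symmetric. -/
lemma covDerivAlong_gradIn_symm (h : IsMetricOn G U) (hf : ContDiffOn ℝ ∞ f U) {ξ : E}
    (hξ : ξ ∈ U) (u w : E) :
    G ξ (covDerivAlong G id (gradIn G f) ξ u) w = G ξ (covDerivAlong G id (gradIn G f) ξ w) u := by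
  have hf2 : ContDiffAt ℝ 2 f ξ :=
    (hf.contDiffAt (h.isOpen.mem_nhds hξ)).of_le ENat.LEInfty.out
  have key : ∀ u w, G ξ (covDerivAlong G id (gradIn G f) ξ u) w
      = fderiv ℝ (fderiv ℝ f) ξ u w - fderiv ℝ f ξ (christoffel G ξ u w) := by
    intro u w
    have h1 := fderiv_metric_apply (φ := id) h hξ (W := fun _ => w) differentiableAt_id
      ((h.contDiffAt_gradIn hf hξ).differentiableAt (by simp)) (differentiableAt_const w) u
    have h2 : (fun ζ => G (id ζ) (gradIn G f ζ) w) =ᶠ[𝓝 ξ] fun ζ => fderiv ℝ f ζ w :=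
      eventually_of_mem (h.isOpen.mem_nhds hξ) fun ζ hζ => h.gradIn_apply hζ w
    have h3 : covDerivAlong G id (fun _ => w) ξ u = christoffel G ξ u w := by simp [covDerivAlong]
    rw [h2.fderiv_eq, fderiv_fderiv_const_apply hf2, h3, id, h.gradIn_apply hξ] at h1
    rw [h1]
    ring
  rw [key, key, fderiv_fderiv_symm hf2, h.christoffel_symm hξ]

/-- `grad |grad f|² = 2 ∇_{grad f} grad f`. -/
lemma gradIn_norm_sq (h : IsMetricOn G U) (hf : ContDiffOn ℝ ∞ f U) {ξ : E} (hξ : ξ ∈ U) :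
    gradIn G (fun ζ => G ζ (gradIn G f ζ) (gradIn G f ζ)) ξ
      = (2 : ℝ) • covDerivAlong G id (gradIn G f) ξ (gradIn G f ξ) := by
  refine h.eq_of_forall hξ fun w => ?_
  have hd := (h.contDiffAt_gradIn hf hξ).differentiableAt (by simp)
  have h1 := fderiv_metric_apply (φ := id) h hξ differentiableAt_id hd hd w
  simp only [id] at h1
  rw [h.gradIn_apply hξ, h1, map_smul, smul_apply, h.symm ξ hξ (gradIn G f ξ),
    h.covDerivAlong_gradIn_symm hf hξ, smul_eq_mul]
  ring

lemma differentiableAt_connectionMap (h : IsMetricOn G U) (hz : z.1 ∈ U) :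
    DifferentiableAt ℝ (connectionMap G) z :=
  (h.contDiffAt_connectionMap hz).differentiableAt (by simp)

/-- Leibniz rule for the connection map applied to a vector field. -/
lemma covDerivAlong_connectionMap (h : IsMetricOn G U) (hz : z.1 ∈ U) {W : E × E → E × E}
    (hW : DifferentiableAt ℝ W z) (u : E × E) :
    covDerivAlong G Prod.fst (fun ζ => connectionMap G ζ (W ζ)) z u
      = covDerivAlong G Prod.fst (fun ζ => connectionMap G ζ (W z)) z u
        + connectionMap G z (fderiv ℝ W z u) := by
  have hd := h.differentiableAt_connectionMap hz
  have h2 := fderiv_linear_apply hd (differentiableAt_const (W z)) u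
  simp only [covDerivAlong, fderiv_linear_apply hd hW, h2, fderiv_fun_const]
  simp
  abel

end IsMetricOn

namespace IsFlatWarpingOn

lemma isMetricOn_warped (h : IsFlatWarpingOn G f U) : IsMetricOn (warpedForm G f) (U ×ˢ univ) :=
  h.toIsMetricOn.isMetricOn_warpedForm h.contDiffOn_warp h.warp_pos

/-- The vertical part of the Sasaki connection of a flat metric is symmetric. -/
lemma covDerivAlong_connectionMap_symm (h : IsFlatWarpingOn G f U) (hz : z.1 ∈ U) (u v : E × E) :
    covDerivAlong G Prod.fst (fun ζ => connectionMap G ζ v) z u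
      = covDerivAlong G Prod.fst (fun ζ => connectionMap G ζ u) z v := by
  have := covDerivAlong_commutator (φ := (Prod.fst : E × E → E)) (V := Prod.snd)
    (h.differentiableAt_christoffel hz) contDiffAt_fst contDiffAt_snd u v
  rw [h.flat _ hz, sub_eq_zero] at this
  simpa only [covDerivAlong_snd] using this

/-- The Levi-Civita connection of the warped metric on the tangent bundle of a flat manifold. -/
lemma christoffel_warpedForm (h : IsFlatWarpingOn G f U) (hz : z.1 ∈ U) (v w : E × E) :
    (christoffel (warpedForm G f) z v w).1
        = christoffel G z.1 v.1 w.1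
          - (1 / 2 * G z.1 (connectionMap G z v) (connectionMap G z w)) • gradIn G f z.1 ∧
    connectionMap G z (christoffel (warpedForm G f) z v w)
        = covDerivAlong G Prod.fst (fun ζ => connectionMap G ζ w) z v
          + (fderiv ℝ (halfLog f) z.1 v.1 • connectionMap G z w
            + fderiv ℝ (halfLog f) z.1 w.1 • connectionMap G z v) := by
  set X : E × E → E × E → E := fun v w => christoffel G z.1 v.1 w.1
          - (1 / 2 * G z.1 (connectionMap G z v) (connectionMap G z w)) • gradIn G f z.1 with hX
  set Y : E × E → E × E → E := fun v w =>
        covDerivAlong G Prod.fst (fun ζ => connectionMap G ζ w) z v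
          + (fderiv ℝ (halfLog f) z.1 v.1 • connectionMap G z w
            + fderiv ℝ (halfLog f) z.1 w.1 • connectionMap G z v) with hY
  have hXs : ∀ v w, X v w = X w v := fun v w => by
    simp only [hX, h.christoffel_symm hz v.1, h.symm _ hz (connectionMap G z v)]
  have hYs : ∀ v w, Y v w = Y w v := fun v w => by
    simp only [hY]
    rw [h.covDerivAlong_connectionMap_symm hz, add_comm (_ • _)]
  set T : E × E → E × E → E × E := fun v w => (X v w, Y v w - christoffel G z.1 (X v w) z.2) with hT
  have hcT : ∀ v w, connectionMap G z (T v w) = Y v w := fun v w => by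
    simp [hT, connectionMap_apply]
  have hf : DifferentiableAt ℝ f z.1 :=
    (h.contDiffOn_warp.contDiffAt (h.isOpen.mem_nhds hz)).differentiableAt (by simp)
  have hmetric : ∀ u v w, fderiv ℝ (warpedForm G f) z u v w
      = warpedForm G f z (T u v) w + warpedForm G f z v (T u w) := by
    intro u v w
    have hS := h.isMetricOn_warped.differentiableAt (ξ := z) ⟨hz, mem_univ _⟩
    have h1 := fderiv_bilinear_apply hS (differentiableAt_const v) (differentiableAt_const w) u
    have hc := h.differentiableAt_connectionMap hz
    have hcv : ∀ v, DifferentiableAt ℝ (fun ζ => connectionMap G ζ v) z := fun v =>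
      hc.clm_apply (differentiableAt_const v)
    have hGz : DifferentiableAt ℝ (fun ζ : E × E => G ζ.1) z :=
      (h.differentiableAt hz).comp z differentiableAt_fst
    have hfz : DifferentiableAt ℝ (fun ζ : E × E => f ζ.1) z := hf.comp z differentiableAt_fst
    have h2 : fderiv ℝ (fun ζ : E × E => f ζ.1) z u = fderiv ℝ f z.1 u.1 := by
      have := fderiv_comp z hf (differentiableAt_fst (p := z))
      simp only [Function.comp_def] at this
      rw [this, fderiv_fst]
      rfl
    have h3 := fderiv_metric_apply (φ := (Prod.fst : E × E → E)) h.toIsMetricOn hz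
      differentiableAt_fst (differentiableAt_const v.1) (differentiableAt_const w.1) u
    have h4 := fderiv_metric_apply (φ := (Prod.fst : E × E → E)) h.toIsMetricOn hz
      differentiableAt_fst (hcv v) (hcv w) u
    have h5 : DifferentiableAt ℝ (fun ζ : E × E => G ζ.1 v.1 w.1) z :=
      (hGz.clm_apply (differentiableAt_const _)).clm_apply (differentiableAt_const _)
    have h6 : DifferentiableAt ℝ
      (fun ζ : E × E => G ζ.1 (connectionMap G ζ v) (connectionMap G ζ w)) z :=
      (hGz.clm_apply (hcv v)).clm_apply (hcv w)
    have h7 : fderiv ℝ (fun ζ => warpedForm G f ζ v w) z u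
        = (G z.1 (christoffel G z.1 u.1 v.1) w.1 + G z.1 v.1 (christoffel G z.1 u.1 w.1))
          + (f z.1 * (G z.1 (covDerivAlong G Prod.fst (fun ζ => connectionMap G ζ v) z u)
                  (connectionMap G z w)
                + G z.1 (connectionMap G z v)
                  (covDerivAlong G Prod.fst (fun ζ => connectionMap G ζ w) z u))
            + G z.1 (connectionMap G z v) (connectionMap G z w) * fderiv ℝ f z.1 u.1) := by
      simp only [warpedForm_apply]
      rw [fderiv_fun_add h5 (hfz.fun_mul h6), fderiv_fun_mul hfz h6]
      simp only [add_apply, smul_apply, smul_eq_mul]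
      rw [h2, h3, h4, covDerivAlong_const_fst, covDerivAlong_const_fst]
    rw [h7] at h1
    simp only [fderiv_fun_const, Pi.zero_apply, zero_apply, map_zero,
      add_zero] at h1
    rw [← h1, warpedForm_apply, warpedForm_apply, hcT, hcT]
    simp only [hT, hX, hY, map_add, map_sub, map_smul, add_apply,
      sub_apply, smul_apply, smul_eq_mul]
    rw [h.symm _ hz v.1 (gradIn G f z.1), h.gradIn_apply hz, h.gradIn_apply hz,
      fderiv_halfLog hf (h.warp_pos _ hz) u.1,
      fderiv_halfLog hf (h.warp_pos _ hz) v.1,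
      fderiv_halfLog hf (h.warp_pos _ hz) w.1,
      h.symm _ hz (connectionMap G z v) (connectionMap G z u)]
    ring
  have huniq := h.isMetricOn_warped.eq_christoffel (ξ := z) ⟨hz, mem_univ _⟩ (T := T)
    (fun u v => by simp only [hT, hXs u v, hYs u v]) hmetric v w
  rw [← huniq]
  exact ⟨rfl, hcT v w⟩

lemma christoffel_sasakiForm (h : IsFlatWarpingOn G f U) (hz : z.1 ∈ U) (v w : E × E) :
    (christoffel (warpedForm G fun _ => 1) z v w).1 = christoffel G z.1 v.1 w.1 ∧
    connectionMap G z (christoffel (warpedForm G fun _ => 1) z v w)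
        = covDerivAlong G Prod.fst (fun ζ => connectionMap G ζ w) z v := by
  have h1 := h.const_one.christoffel_warpedForm hz v w
  have h2 : gradIn G (fun _ => (1 : ℝ)) z.1 = 0 := by simp [gradIn]
  have h3 : fderiv ℝ (halfLog fun _ : E => (1 : ℝ)) z.1 = 0 := by
    unfold halfLog
    simp
  rw [h2, h3] at h1
  simpa using h1

/-- Covariant derivatives for the warped metric, in terms of horizontal and vertical parts. -/
lemma covDerivAlong_warpedForm (h : IsFlatWarpingOn G f U) (hz : z.1 ∈ U) {W : E × E → E × E}
    (hW : DifferentiableAt ℝ W z) (u : E × E) :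
    (covDerivAlong (warpedForm G f) id W z u).1
        = covDerivAlong G Prod.fst (fun ζ => (W ζ).1) z u
          - (1 / 2 * G z.1 (connectionMap G z u) (connectionMap G z (W z))) • gradIn G f z.1 ∧
    connectionMap G z (covDerivAlong (warpedForm G f) id W z u)
        = covDerivAlong G Prod.fst (fun ζ => connectionMap G ζ (W ζ)) z u
          + (fderiv ℝ (halfLog f) z.1 u.1 • connectionMap G z (W z)
            + fderiv ℝ (halfLog f) z.1 (W z).1 • connectionMap G z u) := by
  obtain ⟨h1, h2⟩ := h.christoffel_warpedForm hz u (W z)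
  have h3 : covDerivAlong (warpedForm G f) id W z u
      = fderiv ℝ W z u + christoffel (warpedForm G f) z u (W z) := by
    simp [covDerivAlong]
  have h4 : fderiv ℝ (fun ζ => (W ζ).1) z u = (fderiv ℝ W z u).1 := by
    rw [hW.hasFDerivAt.fst.fderiv]
    rfl
  constructor
  · rw [h3, Prod.fst_add, h1, covDerivAlong, h4, fderiv_fst]
    simp only [ContinuousLinearMap.coe_fst']
    abel
  · rw [h3, map_add, h2, h.covDerivAlong_connectionMap hz hW]
    abel

end IsFlatWarpingOn

end SasakiCoordinates

section Bilinear

variable {E : Type*} [NormedAddCommGroup E] [NormedSpace ℝ E]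
  {F : Type*} [NormedAddCommGroup F] [NormedSpace ℝ F]

/-- The map `B` is bilinear. -/
structure IsBilinear (B : E → E → F) : Prop where
  add_left : ∀ u v w, B (u + v) w = B u w + B v w
  smul_left : ∀ (c : ℝ) u w, B (c • u) w = c • B u w
  add_right : ∀ u v w, B u (v + w) = B u v + B u w
  smul_right : ∀ (c : ℝ) u w, B u (c • w) = c • B u w

lemma IsBilinear.metricTrace_eq_sum [FiniteDimensional ℝ E] {ι : Type*} [Fintype ι] [DecidableEq ι]
    {G : E →L[ℝ] E →L[ℝ] ℝ} {B : E → E → F} (hB : IsBilinear B)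
    (hG : G.IsInvertible) (e : Module.Basis ι ℝ E)
    (he : ∀ i j, G (e i) (e j) = if i = j then 1 else 0) :
    metricTrace G B = ∑ i, B (e i) (e i) :=
  RiemGeom.metricTrace_eq_sum hG e he hB.add_left hB.smul_left hB.add_right hB.smul_right

variable {G : E → E →L[ℝ] E →L[ℝ] ℝ} {K : F → F →L[ℝ] F →L[ℝ] ℝ} {φ : E → F} {ξ : E}

lemma isBilinear_secondCovDerivAlong {V : E → F}
    (hK : DifferentiableAt ℝ (christoffel K) (φ ξ)) (hφ : ContDiffAt ℝ 2 φ ξ)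
    (hV : ContDiffAt ℝ 2 V ξ) : IsBilinear (secondCovDerivAlong G K φ V ξ) where
  add_left u v w := by
    simp only [secondCovDerivAlong, covDerivAlong_add_right, map_add, add_apply]
    abel
  smul_left c u w := by
    simp only [secondCovDerivAlong, covDerivAlong_smul_right, map_smul, smul_apply, smul_sub]
  add_right u v w := by
    simp only [secondCovDerivAlong, covDerivAlong_add_right, map_add]
    rw [covDerivAlong_add (differentiableAt_covDerivAlong hK hφ hV v)
      (differentiableAt_covDerivAlong hK hφ hV w)]
    abel
  smul_right c u w := by
    simp only [secondCovDerivAlong, covDerivAlong_smul_right, map_smul]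
    rw [covDerivAlong_smul (differentiableAt_const c)
      (differentiableAt_covDerivAlong hK hφ hV w)]
    simp [smul_sub]

lemma isBilinear_curvature {G : E → E →L[ℝ] E →L[ℝ] ℝ} {ξ : E}
    (hG : DifferentiableAt ℝ (christoffel G) ξ) (a : E) : IsBilinear (curvature G ξ a) := by
  have key : ∀ v w, curvature G ξ a v w = fderiv ℝ (christoffel G) ξ a v w
      - fderiv ℝ (christoffel G) ξ v a w + christoffel G ξ a (christoffel G ξ v w)
      - christoffel G ξ v (christoffel G ξ a w) := fun v w => by
    rw [curvature, fderiv_christoffel_apply hG, fderiv_christoffel_apply hG]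
  constructor <;> intros <;>
    simp only [key, map_add, add_apply, map_smul, smul_apply, smul_sub, smul_add] <;> abel

lemma secondCovDerivAlong_congr {φ' V V' : E → F} (hφ : φ =ᶠ[𝓝 ξ] φ') (hV : V =ᶠ[𝓝 ξ] V')
    (u v : E) : secondCovDerivAlong G K φ V ξ u v = secondCovDerivAlong G K φ' V' ξ u v := by
  have h : (fun ζ => covDerivAlong K φ V ζ v) =ᶠ[𝓝 ξ] fun ζ => covDerivAlong K φ' V' ζ v := by
    filter_upwards [hφ.eventuallyEq_nhds, hV.eventuallyEq_nhds] with ζ h1 h2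
    exact covDerivAlong_congr h1 h2 v
  rw [secondCovDerivAlong, secondCovDerivAlong, covDerivAlong_congr hφ h,
    covDerivAlong_congr hφ hV]

lemma secondFundamentalForm_of_eventuallyEq_id {K : E → E →L[ℝ] E →L[ℝ] ℝ} {φ : E → E}
    (hφ : φ =ᶠ[𝓝 ξ] id) (u v : E) :
    secondFundamentalForm G K φ ξ u v = christoffel K ξ u v - christoffel G ξ u v := by
  have h : (fun ζ => fderiv ℝ φ ζ v) =ᶠ[𝓝 ξ] fun _ => v := by
    filter_upwards [hφ.eventuallyEq_nhds] with ζ h1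
    simp [h1.fderiv_eq]
  simp [secondFundamentalForm, h.fderiv_eq, hφ.fderiv_eq, hφ.eq_of_nhds]

end Bilinear

section SasakiTraces

variable {E : Type*} [NormedAddCommGroup E] [NormedSpace ℝ E]
  {F : Type*} [NormedAddCommGroup F] [NormedSpace ℝ F]
  {G : E → E →L[ℝ] E →L[ℝ] ℝ} {f : E → ℝ} {U : Set E} {z : E × E}

/-- The basis of `E × E` made of horizontal and vertical lifts of a basis of `E`. -/
def liftBasis (G : E → E →L[ℝ] E →L[ℝ] ℝ) (z : E × E) {ι : Type*} (e : Module.Basis ι ℝ E) :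
    Module.Basis (ι ⊕ ι) ℝ (E × E) :=
  (e.prod e).map ((LinearEquiv.refl ℝ E).skewProd (LinearEquiv.refl ℝ E)
    (-((christoffel G z.1).flip z.2)).toLinearMap)

lemma liftBasis_inl {ι : Type*} (e : Module.Basis ι ℝ E) (i : ι) :
    liftBasis G z e (Sum.inl i) = horizontalIn G z (e i) := by
  simp [liftBasis, horizontalIn]

lemma liftBasis_inr {ι : Type*} (e : Module.Basis ι ℝ E) (i : ι) :
    liftBasis G z e (Sum.inr i) = ((0 : E), e i) := by
  simp [liftBasis]

lemma connectionMap_vertical (a : E) : connectionMap G z ((0 : E), a) = a := by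
  simp [connectionMap_apply]

variable [FiniteDimensional ℝ E]

lemma IsMetricOn.metricTrace_sasakiForm (h : IsMetricOn G U) (hz : z.1 ∈ U) {ι : Type*} [Fintype ι]
    [DecidableEq ι] (e : Module.Basis ι ℝ E)
    (he : ∀ i j, G z.1 (e i) (e j) = if i = j then 1 else 0) {B : E × E → E × E → F}
    (hB : IsBilinear B) :
    metricTrace (warpedForm G (fun _ => 1) z) B
      = ∑ i, (B (horizontalIn G z (e i)) (horizontalIn G z (e i))
          + B ((0 : E), e i) ((0 : E), e i)) := by
  have hS := h.isMetricOn_warpedForm (f := fun _ => 1) contDiffOn_const (fun _ _ => one_pos)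
  rw [hB.metricTrace_eq_sum (hS.isInvertible (ξ := z) ⟨hz, mem_univ _⟩) (liftBasis G z e),
    Fintype.sum_sum_type, Finset.sum_add_distrib]
  · simp only [liftBasis_inl, liftBasis_inr]
  · rintro (i | i) (j | j) <;>
      simp only [liftBasis_inl, liftBasis_inr, warpedForm_apply, connectionMap_vertical,
        connectionMap_horizontalIn, Sum.inl.injEq, Sum.inr.injEq, reduceCtorEq] <;>
      simp [he, horizontalIn]

namespace IsFlatWarpingOn

lemma tension_warpedForm (h : IsFlatWarpingOn G f U) (hz : z.1 ∈ U) {φ : E × E → E × E}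
    (hφ : φ =ᶠ[𝓝 z] id) :
    metricTrace (warpedForm G (fun _ => 1) z)
        (secondFundamentalForm (warpedForm G fun _ => 1) (warpedForm G f) φ z)
      = horizontalIn G z (-((Module.finrank ℝ E : ℝ) / 2) • gradIn G f z.1) := by
  obtain ⟨e, he⟩ := exists_orthonormal_basis (h.symm _ hz) (h.pos _ hz)
  have hB : ∀ u v, secondFundamentalForm (warpedForm G fun _ => 1) (warpedForm G f) φ z u v
      = christoffel (warpedForm G f) z u v - christoffel (warpedForm G fun _ => 1) z u v :=
    secondFundamentalForm_of_eventuallyEq_id hφ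
  rw [h.metricTrace_sasakiForm hz e he]
  · refine prod_eq_of_connectionMap (G := G) (z := z) ?_ ?_
    · simp only [hB, Prod.fst_sum, Prod.fst_add, Prod.fst_sub, (h.christoffel_warpedForm hz _ _).1,
        (h.christoffel_sasakiForm hz _ _).1, connectionMap_vertical, connectionMap_horizontalIn, he]
      simp [horizontalIn, ← Nat.cast_smul_eq_nsmul ℝ, smul_smul]
      ring_nf
    · rw [connectionMap_horizontalIn]
      simp only [hB, map_sum, map_add, map_sub, (h.christoffel_warpedForm hz _ _).2,
        (h.christoffel_sasakiForm hz _ _).2, connectionMap_vertical, connectionMap_horizontalIn]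
      simp
  · constructor <;> intros <;> simp only [hB, map_add, add_apply, map_smul, smul_apply, smul_sub]
      <;> abel

variable {α : E → E}

lemma contDiffAt_horizontalIn (h : IsFlatWarpingOn G f U) (hα : ContDiffOn ℝ ∞ α U)
    (hz : z.1 ∈ U) : ContDiffAt ℝ ∞ (fun ζ : E × E => horizontalIn G ζ (α ζ.1)) z := by
  have h1 : ContDiffAt ℝ ∞ (fun ζ : E × E => christoffel G ζ.1) z :=
    (h.contDiffAt_christoffel hz).comp z contDiffAt_fst
  have h2 : ContDiffAt ℝ ∞ (fun ζ : E × E => α ζ.1) z :=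
    (hα.contDiffAt (h.isOpen.mem_nhds hz)).comp z contDiffAt_fst
  exact h2.prodMk ((h1.clm_apply h2).clm_apply contDiffAt_snd).neg

lemma covDerivAlong_horizontalIn (h : IsFlatWarpingOn G f U) (hα : ContDiffOn ℝ ∞ α U)
    (hz : z.1 ∈ U) (v : E × E) :
    (covDerivAlong (warpedForm G f) id (fun ζ => horizontalIn G ζ (α ζ.1)) z v).1
        = covDerivAlong G id α z.1 v.1 ∧
    connectionMap G z (covDerivAlong (warpedForm G f) id (fun ζ => horizontalIn G ζ (α ζ.1)) z v)
        = fderiv ℝ (halfLog f) z.1 (α z.1) • connectionMap G z v := by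
  have hd := (h.contDiffAt_horizontalIn hα hz).differentiableAt (by simp)
  have hα' : DifferentiableAt ℝ α z.1 :=
    (hα.contDiffAt (h.isOpen.mem_nhds hz)).differentiableAt (by simp)
  obtain ⟨h1, h2⟩ := h.covDerivAlong_warpedForm hz hd v
  constructor
  · rw [h1, connectionMap_horizontalIn]
    simpa [horizontalIn] using covDerivAlong_comp_fst hα' v
  · rw [h2]
    simp only [connectionMap_horizontalIn]
    simp [covDerivAlong, horizontalIn]

lemma secondCovDerivAlong_horizontalIn (h : IsFlatWarpingOn G f U) (hα : ContDiffOn ℝ ∞ α U)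
    (hz : z.1 ∈ U) (u v : E × E) :
    (secondCovDerivAlong (warpedForm G fun _ => 1) (warpedForm G f) id
        (fun ζ => horizontalIn G ζ (α ζ.1)) z u v).1
      = secondCovDerivAlong G G id α z.1 u.1 v.1
        - (1 / 2 * fderiv ℝ (halfLog f) z.1 (α z.1)
            * G z.1 (connectionMap G z u) (connectionMap G z v)) • gradIn G f z.1 ∧
    connectionMap G z (secondCovDerivAlong (warpedForm G fun _ => 1) (warpedForm G f) id
        (fun ζ => horizontalIn G ζ (α ζ.1)) z u v)
      = fderiv ℝ (fun ζ => fderiv ℝ (halfLog f) ζ (α ζ)) z.1 u.1 • connectionMap G z v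
        + (fderiv ℝ (halfLog f) z.1 u.1 • fderiv ℝ (halfLog f) z.1 (α z.1) • connectionMap G z v
          + fderiv ℝ (halfLog f) z.1 (covDerivAlong G id α z.1 v.1) • connectionMap G z u) := by
  set V : E × E → E × E := fun ζ => horizontalIn G ζ (α ζ.1) with hV
  set κ : E → ℝ := fun ζ => fderiv ℝ (halfLog f) ζ (α ζ) with hκ
  have hzU : (U ×ˢ univ : Set (E × E)) ∈ 𝓝 z :=
    (h.isOpen.prod isOpen_univ).mem_nhds ⟨hz, mem_univ _⟩
  have hW : DifferentiableAt ℝ (fun ζ => covDerivAlong (warpedForm G f) id V ζ v) z :=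
    (contDiffAt_covDerivAlong
      (h.isMetricOn_warped.contDiffAt_christoffel (ξ := id z) ⟨hz, mem_univ _⟩)
      contDiffAt_id (h.contDiffAt_horizontalIn hα hz) v).differentiableAt (by simp)
  have hα' := hα.contDiffAt (h.isOpen.mem_nhds hz)
  have hκd : DifferentiableAt ℝ κ z.1 :=
    (((h.contDiffAt_halfLog hz).fderiv_right (m := ∞) (by simp)).clm_apply
      hα').differentiableAt (by simp)
  have hκz : DifferentiableAt ℝ (fun ζ : E × E => κ ζ.1) z := hκd.comp z differentiableAt_fst
  have hκ' : fderiv ℝ (fun ζ : E × E => κ ζ.1) z u = fderiv ℝ κ z.1 u.1 := by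
    have := fderiv_comp z hκd (differentiableAt_fst (p := z))
    simp only [Function.comp_def] at this
    rw [this, fderiv_fst]
    rfl
  have hβ : DifferentiableAt ℝ (fun ξ => covDerivAlong G id α ξ v.1) z.1 :=
    (contDiffAt_covDerivAlong (h.contDiffAt_christoffel (ξ := id z.1) hz) contDiffAt_id hα'
      v.1).differentiableAt (by simp)
  have e1 : (fun ζ => (covDerivAlong (warpedForm G f) id V ζ v).1)
      =ᶠ[𝓝 z] fun ζ => covDerivAlong G id α ζ.1 v.1 :=
    eventually_of_mem hzU fun ζ hζ => (h.covDerivAlong_horizontalIn hα hζ.1 v).1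
  have e2 : (fun ζ => connectionMap G ζ (covDerivAlong (warpedForm G f) id V ζ v))
      =ᶠ[𝓝 z] fun ζ => κ ζ.1 • connectionMap G ζ v :=
    eventually_of_mem hzU fun ζ hζ => (h.covDerivAlong_horizontalIn hα hζ.1 v).2
  have hδ : DifferentiableAt ℝ (fun ζ => connectionMap G ζ v) z :=
    (h.differentiableAt_connectionMap hz).clm_apply (differentiableAt_const v)
  obtain ⟨a1, a2⟩ := h.covDerivAlong_warpedForm hz hW u
  obtain ⟨b1, b2⟩ := h.covDerivAlong_horizontalIn hα hz (christoffel (warpedForm G fun _ => 1) z u v)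
  obtain ⟨c1, c2⟩ := h.christoffel_sasakiForm hz u v
  obtain ⟨d1, d2⟩ := h.covDerivAlong_horizontalIn hα hz v
  rw [secondCovDerivAlong]
  constructor
  · rw [Prod.fst_sub, a1, b1, c1, covDerivAlong_congr (EventuallyEq.refl _ _) e1,
      covDerivAlong_comp_fst hβ, d2, secondCovDerivAlong, map_smul, smul_eq_mul]
    rw [sub_right_comm]
    ring_nf
  · rw [map_sub, a2, b2, c2, covDerivAlong_congr (EventuallyEq.refl _ _) e2,
      covDerivAlong_smul hκz hδ, hκ', d1, d2]
    abel

lemma trace_secondCovDerivAlong_horizontalIn (h : IsFlatWarpingOn G f U) (hα : ContDiffOn ℝ ∞ α U)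
    (hz : z.1 ∈ U) :
    metricTrace (warpedForm G (fun _ => 1) z)
        (secondCovDerivAlong (warpedForm G fun _ => 1) (warpedForm G f) id
          (fun ζ => horizontalIn G ζ (α ζ.1)) z)
      = horizontalIn G z (metricTrace (G z.1) (secondCovDerivAlong G G id α z.1)
          - ((Module.finrank ℝ E : ℝ) / 2 * fderiv ℝ (halfLog f) z.1 (α z.1))
            • gradIn G f z.1) := by
  obtain ⟨e, he⟩ := exists_orthonormal_basis (h.symm _ hz) (h.pos _ hz)
  have hα' := (hα.contDiffAt (h.isOpen.mem_nhds hz)).of_le (m := 2) ENat.LEInfty.out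
  have hBG : IsBilinear (secondCovDerivAlong G G id α z.1) :=
    isBilinear_secondCovDerivAlong (h.differentiableAt_christoffel (ξ := id z.1) hz)
      contDiffAt_id hα'
  have hB : IsBilinear (secondCovDerivAlong (warpedForm G fun _ => 1) (warpedForm G f) id
          (fun ζ => horizontalIn G ζ (α ζ.1)) z) :=
    isBilinear_secondCovDerivAlong
      (h.isMetricOn_warped.differentiableAt_christoffel (ξ := id z) ⟨hz, mem_univ _⟩)
      contDiffAt_id ((h.contDiffAt_horizontalIn hα hz).of_le ENat.LEInfty.out)
  have h0 : secondCovDerivAlong G G id α z.1 0 0 = 0 := by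
    simpa using hBG.smul_left 0 0 0
  have h00 : covDerivAlong G id α z.1 0 = 0 := by
    simpa using covDerivAlong_smul_right (K := G) (φ := id) (V := α) (ξ := z.1) 0 (0 : E)
  rw [h.metricTrace_sasakiForm hz e he hB, hBG.metricTrace_eq_sum (h.isInvertible hz) e he]
  refine prod_eq_of_connectionMap (G := G) (z := z) ?_ ?_
  · simp only [Prod.fst_sum, Prod.fst_add, (h.secondCovDerivAlong_horizontalIn hα hz _ _).1,
      connectionMap_vertical, connectionMap_horizontalIn, he, h0]
    simp [horizontalIn, ← Nat.cast_smul_eq_nsmul ℝ, smul_smul, Finset.sum_add_distrib,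
      sub_eq_add_neg]
    ring_nf
  · rw [connectionMap_horizontalIn]
    simp only [map_sum, map_add, (h.secondCovDerivAlong_horizontalIn hα hz _ _).2,
      connectionMap_vertical, connectionMap_horizontalIn, h00]
    simp

/-- Second covariant derivatives of a constant field for the warped metric. -/
lemma covDerivAlong_covDerivAlong_const (h : IsFlatWarpingOn G f U) (hz : z.1 ∈ U)
    (q p w : E × E) :
    (covDerivAlong (warpedForm G f) id
        (fun ζ => covDerivAlong (warpedForm G f) id (fun _ => w) ζ p) z q).1
      = covDerivAlong G Prod.fst (fun ζ => covDerivAlong G Prod.fst (fun _ => w.1) ζ p) z q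
        - ((1 / 2 * (G z.1 (covDerivAlong G Prod.fst (fun ζ => connectionMap G ζ p) z q)
              (connectionMap G z w)
            + G z.1 (connectionMap G z p)
              (covDerivAlong G Prod.fst (fun ζ => connectionMap G ζ w) z q))) • gradIn G f z.1
          + (1 / 2 * G z.1 (connectionMap G z p) (connectionMap G z w))
            • covDerivAlong G id (gradIn G f) z.1 q.1)
        - (1 / 2 * G z.1 (connectionMap G z q)
            (covDerivAlong G Prod.fst (fun ζ => connectionMap G ζ w) z p
              + (fderiv ℝ (halfLog f) z.1 p.1 • connectionMap G z w
                + fderiv ℝ (halfLog f) z.1 w.1 • connectionMap G z p))) • gradIn G f z.1 ∧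
    connectionMap G z (covDerivAlong (warpedForm G f) id
        (fun ζ => covDerivAlong (warpedForm G f) id (fun _ => w) ζ p) z q)
      = covDerivAlong G Prod.fst
          (fun ζ => covDerivAlong G Prod.fst (fun η => connectionMap G η w) ζ p) z q
        + ((fderiv ℝ (fderiv ℝ (halfLog f)) z.1 q.1 p.1 • connectionMap G z w
            + fderiv ℝ (halfLog f) z.1 p.1
              • covDerivAlong G Prod.fst (fun ζ => connectionMap G ζ w) z q)
          + (fderiv ℝ (fderiv ℝ (halfLog f)) z.1 q.1 w.1 • connectionMap G z p
            + fderiv ℝ (halfLog f) z.1 w.1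
              • covDerivAlong G Prod.fst (fun ζ => connectionMap G ζ p) z q))
        + (fderiv ℝ (halfLog f) z.1 q.1
            • (covDerivAlong G Prod.fst (fun ζ => connectionMap G ζ w) z p
              + (fderiv ℝ (halfLog f) z.1 p.1 • connectionMap G z w
                + fderiv ℝ (halfLog f) z.1 w.1 • connectionMap G z p))
          + fderiv ℝ (halfLog f) z.1 (christoffel G z.1 p.1 w.1
              - (1 / 2 * G z.1 (connectionMap G z p) (connectionMap G z w)) • gradIn G f z.1)
            • connectionMap G z q) := by
  have hzU : (U ×ˢ univ : Set (E × E)) ∈ 𝓝 z :=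
    (h.isOpen.prod isOpen_univ).mem_nhds ⟨hz, mem_univ _⟩
  have hW : DifferentiableAt ℝ (fun ζ => covDerivAlong (warpedForm G f) id (fun _ => w) ζ p) z :=
    (contDiffAt_covDerivAlong
      (h.isMetricOn_warped.contDiffAt_christoffel (ξ := id z) ⟨hz, mem_univ _⟩)
      contDiffAt_id contDiffAt_const p).differentiableAt (by simp)
  have hc : ∀ v, ContDiffAt ℝ ∞ (fun ζ => connectionMap G ζ v) z := fun v =>
    (h.contDiffAt_connectionMap hz).clm_apply contDiffAt_const
  have hcd : ∀ v, DifferentiableAt ℝ (fun ζ => connectionMap G ζ v) z := fun v =>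
    (hc v).differentiableAt (by simp)
  have hA : DifferentiableAt ℝ (fun ζ => covDerivAlong G Prod.fst (fun _ => w.1) ζ p) z :=
    (contDiffAt_covDerivAlong (φ := (Prod.fst : E × E → E)) (h.contDiffAt_christoffel hz)
      contDiffAt_fst contDiffAt_const p).differentiableAt (by simp)
  have hC : DifferentiableAt ℝ
      (fun ζ => covDerivAlong G Prod.fst (fun η => connectionMap G η w) ζ p) z :=
    (contDiffAt_covDerivAlong (φ := (Prod.fst : E × E → E)) (h.contDiffAt_christoffel hz)
      contDiffAt_fst (hc w) p).differentiableAt (by simp)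
  have hGz : DifferentiableAt ℝ (fun ζ : E × E => G ζ.1) z :=
    (h.differentiableAt hz).comp z differentiableAt_fst
  have hGpw : DifferentiableAt ℝ
      (fun ζ => 1 / 2 * G ζ.1 (connectionMap G ζ p) (connectionMap G ζ w)) z :=
    ((hGz.clm_apply (hcd p)).clm_apply (hcd w)).const_mul _
  have hGpw' : fderiv ℝ (fun ζ => 1 / 2 * G ζ.1 (connectionMap G ζ p) (connectionMap G ζ w)) z q
      = 1 / 2 * (G z.1 (covDerivAlong G Prod.fst (fun ζ => connectionMap G ζ p) z q)
              (connectionMap G z w)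
            + G z.1 (connectionMap G z p)
              (covDerivAlong G Prod.fst (fun ζ => connectionMap G ζ w) z q)) := by
    rw [fderiv_const_mul ((hGz.clm_apply (hcd p)).clm_apply (hcd w)), smul_apply, smul_eq_mul,
      ← fderiv_metric_apply (φ := (Prod.fst : E × E → E)) h.toIsMetricOn hz differentiableAt_fst
        (hcd p) (hcd w)]
  have hN : DifferentiableAt ℝ (gradIn G f) z.1 :=
    (h.contDiffAt_gradIn h.contDiffOn_warp hz).differentiableAt (by simp)
  have hNz : DifferentiableAt ℝ (fun ζ : E × E => gradIn G f ζ.1) z :=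
    hN.comp z differentiableAt_fst
  have hL : ContDiffAt ℝ 2 (halfLog f) z.1 := (h.contDiffAt_halfLog hz).of_le ENat.LEInfty.out
  have hl : ∀ a, DifferentiableAt ℝ (fun ζ => fderiv ℝ (halfLog f) ζ a) z.1 := fun a =>
    ((hL.fderiv_right (m := 1) (by norm_num)).differentiableAt (by norm_num)).clm_apply
      (differentiableAt_const a)
  have hlz : ∀ a, DifferentiableAt ℝ (fun ζ : E × E => fderiv ℝ (halfLog f) ζ.1 a) z := fun a =>
    (hl a).comp z differentiableAt_fst
  have hlz' : ∀ a, fderiv ℝ (fun ζ : E × E => fderiv ℝ (halfLog f) ζ.1 a) z q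
      = fderiv ℝ (fderiv ℝ (halfLog f)) z.1 q.1 a := fun a => by
    have := fderiv_comp z (hl a) (differentiableAt_fst (p := z))
    simp only [Function.comp_def] at this
    rw [this, fderiv_fst, ← fderiv_fderiv_const_apply hL]
    rfl
  have key : ∀ ζ : E × E, ζ.1 ∈ U →
      (covDerivAlong (warpedForm G f) id (fun _ => w) ζ p).1
        = covDerivAlong G Prod.fst (fun _ => w.1) ζ p
          - (1 / 2 * G ζ.1 (connectionMap G ζ p) (connectionMap G ζ w)) • gradIn G f ζ.1 ∧
      connectionMap G ζ (covDerivAlong (warpedForm G f) id (fun _ => w) ζ p)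
        = covDerivAlong G Prod.fst (fun η => connectionMap G η w) ζ p
          + (fderiv ℝ (halfLog f) ζ.1 p.1 • connectionMap G ζ w
            + fderiv ℝ (halfLog f) ζ.1 w.1 • connectionMap G ζ p) := fun ζ hζ =>
    h.covDerivAlong_warpedForm hζ (differentiableAt_const w) p
  have e1 := eventually_of_mem hzU fun ζ hζ => (key ζ hζ.1).1
  have e2 := eventually_of_mem hzU fun ζ hζ => (key ζ hζ.1).2
  obtain ⟨a1, a2⟩ := h.covDerivAlong_warpedForm hz hW q
  obtain ⟨b1, b2⟩ := key z hz
  constructor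
  · rw [a1, b2, covDerivAlong_congr (EventuallyEq.refl _ _) e1,
      covDerivAlong_sub hA (hGpw.fun_smul hNz), covDerivAlong_smul hGpw hNz, hGpw',
      covDerivAlong_comp_fst hN]
  · rw [a2, b1, b2, covDerivAlong_const_fst, covDerivAlong_congr (EventuallyEq.refl _ _) e2,
      covDerivAlong_add hC (((hlz _).fun_smul (hcd _)).fun_add ((hlz _).fun_smul (hcd _))),
      covDerivAlong_add ((hlz _).fun_smul (hcd _)) ((hlz _).fun_smul (hcd _)),
      covDerivAlong_smul (hlz _) (hcd _), covDerivAlong_smul (hlz _) (hcd _), hlz', hlz']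

lemma curvature_warpedForm (h : IsFlatWarpingOn G f U) (hz : z.1 ∈ U) {u : E × E}
    (hu : connectionMap G z u = 0) (v : E × E) :
    (curvature (warpedForm G f) z u v v).1
      = -(1 / 2 * G z.1 (connectionMap G z v) (connectionMap G z v))
          • (covDerivAlong G id (gradIn G f) z.1 u.1
            - fderiv ℝ (halfLog f) z.1 u.1 • gradIn G f z.1) ∧
    connectionMap G z (curvature (warpedForm G f) z u v v)
      = (fderiv ℝ (fderiv ℝ (halfLog f)) z.1 u.1 v.1
          + fderiv ℝ (halfLog f) z.1 u.1 * fderiv ℝ (halfLog f) z.1 v.1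
          - fderiv ℝ (halfLog f) z.1 (christoffel G z.1 u.1 v.1)) • connectionMap G z v := by
  have hcomm := covDerivAlong_commutator (φ := (id : E × E → E × E)) (V := fun _ => v)
    (h.isMetricOn_warped.differentiableAt_christoffel (ξ := id z) ⟨hz, mem_univ _⟩)
    contDiffAt_id contDiffAt_const u v
  simp only [fderiv_id, ContinuousLinearMap.id_apply, id] at hcomm
  have hA := covDerivAlong_commutator (φ := (Prod.fst : E × E → E)) (V := fun _ => v.1)
    (h.differentiableAt_christoffel hz) contDiffAt_fst contDiffAt_const u v
  have hC := covDerivAlong_commutator (φ := (Prod.fst : E × E → E))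
    (V := fun ζ => connectionMap G ζ v) (h.differentiableAt_christoffel hz) contDiffAt_fst
    (((h.contDiffAt_connectionMap hz).clm_apply contDiffAt_const).of_le ENat.LEInfty.out) u v
  rw [h.flat _ hz, sub_eq_zero] at hA hC
  obtain ⟨a1, a2⟩ := h.covDerivAlong_covDerivAlong_const hz u v v
  obtain ⟨b1, b2⟩ := h.covDerivAlong_covDerivAlong_const hz v u v
  have hL : ContDiffAt ℝ 2 (halfLog f) z.1 := (h.contDiffAt_halfLog hz).of_le ENat.LEInfty.out
  rw [← hcomm]
  change (covDerivAlong (warpedForm G f) id _ z u - covDerivAlong (warpedForm G f) id _ z v).1 = _ ∧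
    connectionMap G z
      (covDerivAlong (warpedForm G f) id _ z u - covDerivAlong (warpedForm G f) id _ z v) = _
  constructor
  · rw [Prod.fst_sub, a1, b1, hA, hu, h.covDerivAlong_connectionMap_symm hz v u]
    simp only [map_zero, zero_apply, map_add, map_smul, smul_zero, smul_eq_mul]
    module
  · rw [map_sub, a2, b2, hC, hu, h.covDerivAlong_connectionMap_symm hz v u,
      fderiv_fderiv_symm hL v.1 u.1]
    simp only [map_zero, zero_apply, smul_zero, mul_zero, zero_smul, sub_zero]
    module

lemma trace_curvature_warpedForm (h : IsFlatWarpingOn G f U) (hz : z.1 ∈ U) (a : E) :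
    metricTrace (warpedForm G (fun _ => 1) z)
        (curvature (warpedForm G f) z (horizontalIn G z a))
      = horizontalIn G z (-((Module.finrank ℝ E : ℝ) / 2) •
          (covDerivAlong G id (gradIn G f) z.1 a
            - fderiv ℝ (halfLog f) z.1 a • gradIn G f z.1)) := by
  obtain ⟨e, he⟩ := exists_orthonormal_basis (h.symm _ hz) (h.pos _ hz)
  have hc := h.curvature_warpedForm hz (connectionMap_horizontalIn (G := G) (z := z) a)
  rw [h.metricTrace_sasakiForm hz e he (isBilinear_curvature
    (h.isMetricOn_warped.differentiableAt_christoffel (ξ := z) ⟨hz, mem_univ _⟩) _)]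
  refine prod_eq_of_connectionMap (G := G) (z := z) ?_ ?_
  · simp only [Prod.fst_sum, Prod.fst_add, (hc _).1, connectionMap_vertical,
      connectionMap_horizontalIn, he]
    simp only [map_zero, mul_zero, neg_zero, zero_smul, if_true, zero_add, Finset.sum_const,
      Finset.card_univ, Fintype.card_fin, ← Nat.cast_smul_eq_nsmul ℝ, smul_smul, horizontalIn]
    ring_nf
  · rw [connectionMap_horizontalIn]
    simp only [map_sum, map_add, (hc _).2, connectionMap_vertical, connectionMap_horizontalIn]
    simp

/-- The bitension field of the identity map, in coordinates. -/
lemma bitension_warpedForm (h : IsFlatWarpingOn G f U) (hz : z.1 ∈ U) :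
    let m : ℝ := Module.finrank ℝ E
    let α : E → E := fun ξ => -(m / 2) • gradIn G f ξ;
    -metricTrace (warpedForm G (fun _ => 1) z)
          (curvature (warpedForm G f) z (horizontalIn G z (α z.1)))
        - metricTrace (warpedForm G (fun _ => 1) z)
          (secondCovDerivAlong (warpedForm G fun _ => 1) (warpedForm G f) id
            (fun ζ => horizontalIn G ζ (α ζ.1)) z)
      = -(m ^ 2 / 8) • horizontalIn G z
            (gradIn G (fun ζ => G ζ (gradIn G f ζ) (gradIn G f ζ)) z.1)
        + (m / 2) • horizontalIn G z
            (metricTrace (G z.1) (secondCovDerivAlong G G id (gradIn G f) z.1)) := by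
  intro m α
  have hN : ContDiffOn ℝ ∞ (gradIn G f) U := fun ξ hξ =>
    (h.contDiffAt_gradIn h.contDiffOn_warp hξ).contDiffWithinAt
  have hα : ContDiffOn ℝ ∞ α U := contDiffOn_const.smul hN
  have hNd : ∀ ξ ∈ U, DifferentiableAt ℝ (gradIn G f) ξ := fun ξ hξ =>
    (hN.contDiffAt (h.isOpen.mem_nhds hξ)).differentiableAt (by simp)
  have hcα : ∀ ξ ∈ U, ∀ u, covDerivAlong G id α ξ u
      = -(m / 2) • covDerivAlong G id (gradIn G f) ξ u := fun ξ hξ u => by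
    rw [covDerivAlong_smul (differentiableAt_const _) (hNd ξ hξ)]
    simp
  have hsα : ∀ u v, secondCovDerivAlong G G id α z.1 u v
      = -(m / 2) • secondCovDerivAlong G G id (gradIn G f) z.1 u v := fun u v => by
    have e : (fun ζ => covDerivAlong G id α ζ v)
        =ᶠ[𝓝 z.1] fun ζ => -(m / 2) • covDerivAlong G id (gradIn G f) ζ v :=
      eventually_of_mem (h.isOpen.mem_nhds hz) fun ζ hζ => hcα ζ hζ v
    have hd : DifferentiableAt ℝ (fun ζ => covDerivAlong G id (gradIn G f) ζ v) z.1 :=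
      differentiableAt_covDerivAlong (h.differentiableAt_christoffel (ξ := id z.1) hz)
        contDiffAt_id ((hN.contDiffAt (h.isOpen.mem_nhds hz)).of_le ENat.LEInfty.out) v
    rw [secondCovDerivAlong, secondCovDerivAlong, covDerivAlong_congr (EventuallyEq.refl _ _) e,
      covDerivAlong_smul (differentiableAt_const _) hd, hcα _ hz]
    simp [smul_sub]
  have htr : metricTrace (G z.1) (secondCovDerivAlong G G id α z.1)
      = -(m / 2) • metricTrace (G z.1) (secondCovDerivAlong G G id (gradIn G f) z.1) := by
    simp only [metricTrace, hsα, Finset.smul_sum]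
  rw [h.trace_curvature_warpedForm hz, h.trace_secondCovDerivAlong_horizontalIn hα hz, htr,
    h.gradIn_norm_sq h.contDiffOn_warp hz]
  refine prod_eq_of_connectionMap (G := G) (z := z) ?_ ?_
  · simp only [Prod.fst_sub, Prod.fst_neg, Prod.fst_add, Prod.smul_fst, horizontalIn, α,
      covDerivAlong_smul_right, map_smul, smul_eq_mul]
    module
  · simp only [map_add, map_sub, map_neg, map_smul, connectionMap_horizontalIn]
    simp

end IsFlatWarpingOn

end SasakiTraces

section Congruence

variable {E : Type*} [NormedAddCommGroup E] [NormedSpace ℝ E]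
  {F : Type*} [NormedAddCommGroup F] [NormedSpace ℝ F]

lemma christoffel_congr {G G' : E → E →L[ℝ] E →L[ℝ] ℝ} {ξ : E} (h : G =ᶠ[𝓝 ξ] G') :
    christoffel G ξ = christoffel G' ξ := by
  simp only [christoffel, koszulForm, h.fderiv_eq, h.eq_of_nhds]

lemma christoffel_eventuallyEq {G G' : E → E →L[ℝ] E →L[ℝ] ℝ} {ξ : E} (h : G =ᶠ[𝓝 ξ] G') :
    christoffel G =ᶠ[𝓝 ξ] christoffel G' := by
  filter_upwards [h.eventuallyEq_nhds] with ζ hζ using christoffel_congr hζ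

lemma curvature_congr {G G' : E → E →L[ℝ] E →L[ℝ] ℝ} {ξ : E} (h : G =ᶠ[𝓝 ξ] G') :
    curvature G ξ = curvature G' ξ := by
  have h1 : ∀ v w, (fun ζ => christoffel G ζ v w) =ᶠ[𝓝 ξ] fun ζ => christoffel G' ζ v w :=
    fun v w => (christoffel_eventuallyEq h).mono fun ζ hζ => by simp only [hζ]
  ext u v w
  simp only [curvature, (h1 _ _).fderiv_eq, christoffel_congr h]

lemma covDerivAlong_congr_metric {K K' : F → F →L[ℝ] F →L[ℝ] ℝ} {φ V : E → F} {ξ : E}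
    (h : K =ᶠ[𝓝 (φ ξ)] K') (u : E) :
    covDerivAlong K φ V ξ u = covDerivAlong K' φ V ξ u := by
  simp only [covDerivAlong, christoffel_congr h]

lemma secondCovDerivAlong_congr_metric {G G' : E → E →L[ℝ] E →L[ℝ] ℝ}
    {K K' : F → F →L[ℝ] F →L[ℝ] ℝ} {φ V : E → F} {ξ : E} (hG : G =ᶠ[𝓝 ξ] G')
    (hK : K =ᶠ[𝓝 (φ ξ)] K') (hφ : ContinuousAt φ ξ) (u v : E) :
    secondCovDerivAlong G K φ V ξ u v = secondCovDerivAlong G' K' φ V ξ u v := by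
  have h : (fun ζ => covDerivAlong K φ V ζ v) =ᶠ[𝓝 ξ] fun ζ => covDerivAlong K' φ V ζ v := by
    filter_upwards [hφ.eventually hK.eventuallyEq_nhds] with ζ h1
    exact covDerivAlong_congr_metric h1 v
  rw [secondCovDerivAlong, secondCovDerivAlong, covDerivAlong_congr (EventuallyEq.refl _ _) h,
    covDerivAlong_congr_metric hK, covDerivAlong_congr_metric hK, christoffel_congr hG]

end Congruence

section Isometry

variable {E : Type*} [NormedAddCommGroup E] [NormedSpace ℝ E] [FiniteDimensional ℝ E]
  {F : Type*} [NormedAddCommGroup F] [NormedSpace ℝ F] [FiniteDimensional ℝ F]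
  {G : E → E →L[ℝ] E →L[ℝ] ℝ} {K : F → F →L[ℝ] F →L[ℝ] ℝ} {U : Set E} {W : Set F} {ψ : E → F}
  {ξ : E}

/-- The behaviour of Christoffel symbols under local isometries. -/
lemma fderiv_christoffel_of_isometry (hG : IsMetricOn G U) (hK : IsMetricOn K W) (hξ : ξ ∈ U)
    (hψξ : ψ ξ ∈ W) (hψ : ContDiffAt ℝ 2 ψ ξ) (hsurj : Function.Surjective (fderiv ℝ ψ ξ))
    (hiso : ∀ᶠ ζ in 𝓝 ξ, ∀ v w, G ζ v w = K (ψ ζ) (fderiv ℝ ψ ζ v) (fderiv ℝ ψ ζ w)) (u v : E) :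
    fderiv ℝ ψ ξ (christoffel G ξ u v) = covDerivAlong K ψ (fun ζ => fderiv ℝ ψ ζ v) ξ u := by
  choose T hT using fun u v => hsurj (covDerivAlong K ψ (fun ζ => fderiv ℝ ψ ζ v) ξ u)
  have hinj : Function.Injective (fderiv ℝ ψ ξ) := by
    rw [injective_iff_map_eq_zero]
    intro a ha
    refine hG.eq_of_forall hξ fun w => ?_
    rw [hiso.self_of_nhds, ha, map_zero, map_zero]
    rfl
  rw [← hT u v]
  congr 1
  refine (hG.eq_christoffel hξ (T := T) (fun u v => hinj ?_) ?_ u v).symm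
  · rw [hT, hT, covDerivAlong_fderiv_symm hK hψξ hψ]
  · intro u v w
    have hd : ∀ v, DifferentiableAt ℝ (fun ζ => fderiv ℝ ψ ζ v) ξ := fun v =>
      ((hψ.fderiv_right (m := 1) (by norm_num)).differentiableAt (by norm_num)).clm_apply
        (differentiableAt_const v)
    have h1 := fderiv_bilinear_apply (hG.differentiableAt hξ) (differentiableAt_const v)
      (differentiableAt_const w) u
    have h2 := fderiv_metric_apply hK hψξ (hψ.differentiableAt (by norm_num)) (hd v) (hd w) u
    have h3 : (fun ζ => G ζ v w) =ᶠ[𝓝 ξ] fun ζ => K (ψ ζ) (fderiv ℝ ψ ζ v) (fderiv ℝ ψ ζ w) :=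
      hiso.mono fun ζ hζ => hζ v w
    rw [h3.fderiv_eq, h2] at h1
    rw [hiso.self_of_nhds, hiso.self_of_nhds, hT, hT, h1]
    simp

lemma covDerivAlong_fderiv_of_isometry (hG : IsMetricOn G U) (hK : IsMetricOn K W) (hξ : ξ ∈ U)
    (hψξ : ψ ξ ∈ W) (hψ : ContDiffAt ℝ 2 ψ ξ) (hsurj : Function.Surjective (fderiv ℝ ψ ξ))
    (hiso : ∀ᶠ ζ in 𝓝 ξ, ∀ v w, G ζ v w = K (ψ ζ) (fderiv ℝ ψ ζ v) (fderiv ℝ ψ ζ w))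
    {V : E → E} (hV : DifferentiableAt ℝ V ξ) (u : E) :
    covDerivAlong K ψ (fun ζ => fderiv ℝ ψ ζ (V ζ)) ξ u
      = fderiv ℝ ψ ξ (covDerivAlong G id V ξ u) := by
  have hd : DifferentiableAt ℝ (fderiv ℝ ψ) ξ :=
    (hψ.fderiv_right (m := 1) (by norm_num)).differentiableAt (by norm_num)
  have h1 := fderiv_christoffel_of_isometry hG hK hξ hψξ hψ hsurj hiso u (V ξ)
  rw [covDerivAlong, fderiv_fderiv_const_apply hψ] at h1
  simp only [covDerivAlong, fderiv_id, ContinuousLinearMap.id_apply, id_eq, map_add, h1]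
  rw [fderiv_linear_apply hd hV]
  abel

/-- The behaviour of the curvature under local isometries. -/
lemma fderiv_curvature_of_isometry (hG : IsMetricOn G U) (hK : IsMetricOn K W) (hξ : ξ ∈ U)
    (hψξ : ψ ξ ∈ W) (hψ : ContDiffAt ℝ ∞ ψ ξ)
    (hsurj : ∀ᶠ ζ in 𝓝 ξ, Function.Surjective (fderiv ℝ ψ ζ))
    (hiso : ∀ᶠ ζ in 𝓝 ξ, ∀ v w, G ζ v w = K (ψ ζ) (fderiv ℝ ψ ζ v) (fderiv ℝ ψ ζ w))
    (u v w : E) :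
    fderiv ℝ ψ ξ (curvature G ξ u v w)
      = curvature K (ψ ξ) (fderiv ℝ ψ ξ u) (fderiv ℝ ψ ξ v) (fderiv ℝ ψ ξ w) := by
  have hψ2 : ContDiffAt ℝ 2 ψ ξ := hψ.of_le ENat.LEInfty.out
  have h2 : ∀ᶠ ζ in 𝓝 ξ, ContDiffAt ℝ 2 ψ ζ := hψ2.eventually (by simp)
  have hev : ∀ v, (fun ζ => covDerivAlong K ψ (fun η => fderiv ℝ ψ η w) ζ v)
      =ᶠ[𝓝 ξ] fun ζ => fderiv ℝ ψ ζ (covDerivAlong G id (fun _ => w) ζ v) := fun v => by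
    filter_upwards [hG.isOpen.mem_nhds hξ,
      hψ.continuousAt.preimage_mem_nhds (hK.isOpen.mem_nhds hψξ), h2, hsurj,
      hiso.eventually_nhds] with ζ a1 a2 a3 a4 a5
    exact covDerivAlong_fderiv_of_isometry hG hK a1 a2 a3 a4 a5 (differentiableAt_const w) v
  have hcov : ∀ u v, covDerivAlong K ψ
      (fun ζ => covDerivAlong K ψ (fun η => fderiv ℝ ψ η w) ζ v) ξ u
        = fderiv ℝ ψ ξ (covDerivAlong G id
            (fun ζ => covDerivAlong G id (fun _ => w) ζ v) ξ u) := fun u v => by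
    rw [covDerivAlong_congr (EventuallyEq.refl _ _) (hev v)]
    exact covDerivAlong_fderiv_of_isometry hG hK hξ hψξ hψ2 hsurj.self_of_nhds hiso
      (differentiableAt_covDerivAlong (hG.differentiableAt_christoffel (ξ := id ξ) hξ)
        contDiffAt_id contDiffAt_const v) u
  have hw : ContDiffAt ℝ 2 (fun ζ => fderiv ℝ ψ ζ w) ξ :=
    ((hψ.fderiv_right (m := ∞) (by simp)).clm_apply contDiffAt_const).of_le ENat.LEInfty.out
  have c1 := covDerivAlong_commutator (hK.differentiableAt_christoffel hψξ) hψ2 hw u v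
  have c2 := covDerivAlong_commutator (φ := id) (V := fun _ => w)
    (hG.differentiableAt_christoffel (ξ := id ξ) hξ) contDiffAt_id contDiffAt_const u v
  simp only [fderiv_id, ContinuousLinearMap.id_apply, id] at c2
  rw [← c1, hcov, hcov, ← map_sub]
  congr 1
  exact c2.symm

end Isometry

section Charts

variable {E : Type*} [NormedAddCommGroup E] [NormedSpace ℝ E]
  {H : Type*} [TopologicalSpace H] (I : ModelWithCorners ℝ E H)
  {M : Type*} [TopologicalSpace M] [ChartedSpace H M]

/-- The transition map between the preferred charts at `x` and `y`. -/
def chartTransition (x y : M) : E → E := fun ξ => extChartAt I y ((extChartAt I x).symm ξ)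

variable {I} {x y w : M} {ξ : E}

lemma symm_chartTransition (hy : (extChartAt I x).symm ξ ∈ (extChartAt I y).source) :
    (extChartAt I y).symm (chartTransition I x y ξ) = (extChartAt I x).symm ξ :=
  (extChartAt I y).left_inv hy

lemma chartTransition_mem_target (hy : (extChartAt I x).symm ξ ∈ (extChartAt I y).source) :
    chartTransition I x y ξ ∈ (extChartAt I y).target :=
  (extChartAt I y).map_source hy

variable [I.Boundaryless]

lemma chartTransition_self : chartTransition I x x =ᶠ[𝓝 (extChartAt I x x)] id :=
  eventually_of_mem (extChartAt_target_mem_nhds x) fun _ hζ => (extChartAt I x).right_inv hζ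

lemma writtenInExtChartAt_id :
    writtenInExtChartAt I I x (id : M → M) =ᶠ[𝓝 (extChartAt I x x)] id :=
  chartTransition_self

lemma eventually_symm_mem_source (hξ : ξ ∈ (extChartAt I x).target)
    (hy : (extChartAt I x).symm ξ ∈ (extChartAt I y).source) :
    ∀ᶠ ζ in 𝓝 ξ, ζ ∈ (extChartAt I x).target ∧
      (extChartAt I x).symm ζ ∈ (extChartAt I y).source := by
  have h1 : ContinuousAt (extChartAt I x).symm ξ := continuousAt_extChartAt_symm'' hξ
  filter_upwards [(isOpen_extChartAt_target x).mem_nhds hξ,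
    h1.preimage_mem_nhds ((isOpen_extChartAt_source y).mem_nhds hy)] with ζ h2 h3
  exact ⟨h2, h3⟩

lemma fderiv_chartTransition_self (hξ : ξ ∈ (extChartAt I x).target) (v : E) :
    fderiv ℝ (chartTransition I x x) ξ v = v := by
  have h1 : chartTransition I x x =ᶠ[𝓝 ξ] id :=
    eventually_of_mem ((isOpen_extChartAt_target x).mem_nhds hξ) fun ζ hζ =>
      (extChartAt I x).right_inv hζ
  rw [h1.fderiv_eq, fderiv_id]
  rfl

variable [IsManifold I ∞ M]

lemma contDiffAt_chartTransition (hξ : ξ ∈ (extChartAt I x).target)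
    (hy : (extChartAt I x).symm ξ ∈ (extChartAt I y).source) :
    ContDiffAt ℝ ∞ (chartTransition I x y) ξ := by
  have := contDiffWithinAt_ext_coord_change (I := I) (n := ∞) y x (y := ξ)
    (by rw [PartialEquiv.trans_source]; exact ⟨hξ, hy⟩)
  rw [I.range_eq_univ, contDiffWithinAt_univ] at this
  exact this

lemma fderiv_chartTransition_comp (hξ : ξ ∈ (extChartAt I x).target)
    (hy : (extChartAt I x).symm ξ ∈ (extChartAt I y).source)
    (hw : (extChartAt I x).symm ξ ∈ (extChartAt I w).source) (v : E) :
    fderiv ℝ (chartTransition I y w) (chartTransition I x y ξ)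
      (fderiv ℝ (chartTransition I x y) ξ v) = fderiv ℝ (chartTransition I x w) ξ v := by
  have h1 : chartTransition I x w
      =ᶠ[𝓝 ξ] chartTransition I y w ∘ chartTransition I x y := by
    filter_upwards [eventually_symm_mem_source hξ hy] with ζ hζ
    simp only [chartTransition, Function.comp]
    rw [(extChartAt I y).left_inv hζ.2]
  rw [h1.fderiv_eq, fderiv_comp]
  · rfl
  · refine (contDiffAt_chartTransition (chartTransition_mem_target hy) ?_).differentiableAt
      (by simp)
    rwa [symm_chartTransition hy]
  · exact (contDiffAt_chartTransition hξ hy).differentiableAt (by simp)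

lemma fderiv_chartTransition_surjective (hξ : ξ ∈ (extChartAt I x).target)
    (hy : (extChartAt I x).symm ξ ∈ (extChartAt I y).source) :
    Function.Surjective (fderiv ℝ (chartTransition I x y) ξ) := by
  intro v
  have hy' := chartTransition_mem_target hy
  have hs := symm_chartTransition hy
  refine ⟨fderiv ℝ (chartTransition I y x) (chartTransition I x y ξ) v, ?_⟩
  have h1 : chartTransition I y x (chartTransition I x y ξ) = ξ := by
    rw [chartTransition, hs, (extChartAt I x).right_inv hξ]
  have := fderiv_chartTransition_comp (x := y) (y := x) (w := y) hy'
    (by rw [hs]; exact (extChartAt I x).map_target hξ) (by rwa [hs]) v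
  rw [h1, fderiv_chartTransition_self hy'] at this
  exact this

lemma symmL_trivializationAt (hξ : ξ ∈ (extChartAt I x).target) (v : E) :
    (trivializationAt E (TangentSpace I) x).symmL ℝ ((extChartAt I x).symm ξ) v
      = fderiv ℝ (chartTransition I x ((extChartAt I x).symm ξ)) ξ v := by
  have hq := (extChartAt I x).map_target hξ
  rw [extChartAt_source] at hq
  rw [TangentBundle.symmL_trivializationAt_eq_core hq, tangentBundleCore_coordChange_achart,
    I.range_eq_univ, fderivWithin_univ, (extChartAt I x).right_inv hξ]
  rfl

lemma metricInChart_eq_fderiv (g : BilinField I M) (hξ : ξ ∈ (extChartAt I x).target) (u v : E) :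
    metricInChart g x ξ u v
      = (show E →L[ℝ] E →L[ℝ] ℝ from g ((extChartAt I x).symm ξ))
          (fderiv ℝ (chartTransition I x ((extChartAt I x).symm ξ)) ξ u)
          (fderiv ℝ (chartTransition I x ((extChartAt I x).symm ξ)) ξ v) := by
  rw [← symmL_trivializationAt hξ, ← symmL_trivializationAt hξ]
  rfl

lemma metricInChart_center (g : BilinField I M) (x : M) :
    metricInChart g x (extChartAt I x x) = g x := by
  ext u v
  have h := metricInChart_eq_fderiv g (mem_extChartAt_target (I := I) x) u v
  rw [extChartAt_to_inv, fderiv_chartTransition_self (mem_extChartAt_target x),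
    fderiv_chartTransition_self (mem_extChartAt_target x)] at h
  exact h

lemma metricInChart_transition (g : BilinField I M) (hξ : ξ ∈ (extChartAt I x).target)
    (hy : (extChartAt I x).symm ξ ∈ (extChartAt I y).source) (u v : E) :
    metricInChart g x ξ u v
      = metricInChart g y (chartTransition I x y ξ) (fderiv ℝ (chartTransition I x y) ξ u)
          (fderiv ℝ (chartTransition I x y) ξ v) := by
  rw [metricInChart_eq_fderiv g hξ, metricInChart_eq_fderiv g (chartTransition_mem_target hy),
    symm_chartTransition hy, fderiv_chartTransition_comp hξ hy (mem_extChartAt_source _),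
    fderiv_chartTransition_comp hξ hy (mem_extChartAt_source _)]

lemma symmL_alongInChart_id (X : ∀ x : M, TangentSpace I x) (hξ : ξ ∈ (extChartAt I x).target) :
    fderiv ℝ (chartTransition I x ((extChartAt I x).symm ξ)) ξ
        (alongInChart (I := I) (J := I) (id : M → M) X x ξ)
      = (show E from X ((extChartAt I x).symm ξ)) := by
  rw [← symmL_trivializationAt hξ]
  have hq := (extChartAt I x).map_target hξ
  rw [extChartAt_source] at hq
  exact (trivializationAt E (TangentSpace I) x).symmL_continuousLinearMapAt (R := ℝ) hq _

lemma eventually_isometry (g : BilinField I M) (hξ : ξ ∈ (extChartAt I x).target)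
    (hy : (extChartAt I x).symm ξ ∈ (extChartAt I y).source) :
    ∀ᶠ ζ in 𝓝 ξ, ∀ v w, metricInChart g x ζ v w
      = metricInChart g y (chartTransition I x y ζ)
          (fderiv ℝ (chartTransition I x y) ζ v) (fderiv ℝ (chartTransition I x y) ζ w) := by
  filter_upwards [eventually_symm_mem_source hξ hy] with ζ hζ v w
  exact metricInChart_transition g hζ.1 hζ.2 v w

end Charts

section Riemannian

variable {E : Type*} [NormedAddCommGroup E] [NormedSpace ℝ E] [FiniteDimensional ℝ E]
  {H : Type*} [TopologicalSpace H] {I : ModelWithCorners ℝ E H} [I.Boundaryless]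
  {M : Type*} [TopologicalSpace M] [ChartedSpace H M] [IsManifold I ∞ M]
  (g : ContMDiffRiemannianMetric I ∞ E (fun x : M => TangentSpace I x))

lemma isMetricOn_metricInChart (x : M) :
    IsMetricOn (metricInChart g.inner x) (extChartAt I x).target where
  isOpen := isOpen_extChartAt_target x
  contDiffOn := by
    rw [contDiffOn_clm_apply]
    intro u
    rw [contDiffOn_clm_apply]
    intro v
    have hs : ∀ u : E, ContMDiffOn I (I.prod 𝓘(ℝ, E)) ∞
        (fun m : M => TotalSpace.mk' E m
          ((trivializationAt E (TangentSpace I) x).symmL ℝ m u)) (chartAt H x).source := by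
      intro u
      have h1 := (trivializationAt E (TangentSpace I : M → Type _) x).contMDiffOn_symm (n := ∞)
        (𝕜 := ℝ) (IB := I)
      have h2 : ContMDiffOn I (I.prod 𝓘(ℝ, E)) ∞ (fun m : M => (m, u)) (chartAt H x).source :=
        (contMDiff_id.prodMk contMDiff_const).contMDiffOn
      refine (h1.comp h2 fun m hm => ?_).congr fun m hm => ?_
      · rw [TangentBundle.trivializationAt_target]
        exact ⟨hm, mem_univ _⟩
      · exact (congrArg (TotalSpace.mk' E m)
          ((trivializationAt E (TangentSpace I) x).symmL_apply (R := ℝ) hm u)).trans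
          ((trivializationAt E (TangentSpace I : M → Type _) x).mk_symm hm u)
    have h1 : ContMDiffOn I (I.prod 𝓘(ℝ, ℝ)) ∞
        (fun m : M => TotalSpace.mk' ℝ (E := Bundle.Trivial M ℝ) m
          (g.inner m ((trivializationAt E (TangentSpace I) x).symmL ℝ m u)
            ((trivializationAt E (TangentSpace I) x).symmL ℝ m v))) (chartAt H x).source :=
      ContMDiffOn.clm_bundle_apply₂ (F₁ := E) (F₂ := E) g.contMDiff.contMDiffOn (hs u) (hs v)
    have h2 : ContMDiffOn I 𝓘(ℝ, ℝ) ∞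
        (fun m : M => g.inner m ((trivializationAt E (TangentSpace I) x).symmL ℝ m u)
            ((trivializationAt E (TangentSpace I) x).symmL ℝ m v)) (chartAt H x).source :=
      fun m hm => ((contMDiffWithinAt_totalSpace).1 (h1 m hm)).2
    have h3 := h2.comp (contMDiffOn_extChartAt_symm (I := I) (n := ∞) x) (fun ξ hξ => by
      have := (extChartAt I x).map_target hξ
      rwa [extChartAt_source] at this)
    exact contMDiffOn_iff_contDiffOn.1 h3
  symm ξ _ u v := g.symm _ _ _
  pos ξ hξ v hv := by
    refine g.pos _ _ fun h0 => hv ?_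
    have hq := (extChartAt I x).map_target hξ
    rw [extChartAt_source] at hq
    have := (trivializationAt E (TangentSpace I) x).continuousLinearMapAt_symmL (R := ℝ) hq v
    exact (this.symm.trans (congrArg _ h0)).trans (map_zero _)

variable {x y : M} {ξ : E}

lemma curvature_metricInChart (hflat : IsFlat g.inner) (hξ : ξ ∈ (extChartAt I x).target)
    (u v w : E) : curvature (metricInChart g.inner x) ξ u v w = 0 := by
  set q := (extChartAt I x).symm ξ with hq
  have hy : (extChartAt I x).symm ξ ∈ (extChartAt I q).source := mem_extChartAt_source q
  have hψ := contDiffAt_chartTransition hξ hy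
  have hsurj : ∀ᶠ ζ in 𝓝 ξ, Function.Surjective (fderiv ℝ (chartTransition I x q) ζ) := by
    filter_upwards [eventually_symm_mem_source hξ hy] with ζ hζ
    exact fderiv_chartTransition_surjective hζ.1 hζ.2
  have h := fderiv_curvature_of_isometry (isMetricOn_metricInChart g x)
    (isMetricOn_metricInChart g q) hξ (chartTransition_mem_target hy) hψ hsurj
    (eventually_isometry g.inner hξ hy) u v w
  have hinj := (LinearMap.injective_iff_surjective
    (f := (fderiv ℝ (chartTransition I x q) ξ).toLinearMap)).2 hsurj.self_of_nhds
  refine hinj ?_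
  rw [map_zero]
  refine h.trans ?_
  exact hflat q _ _ _

lemma isFlatWarpingOn (hflat : IsFlat g.inner) {f : M → ℝ} (hf : ContMDiff I 𝓘(ℝ, ℝ) ∞ f)
    (hpos : ∀ x, 0 < f x) (x : M) :
    IsFlatWarpingOn (metricInChart g.inner x) (fun ξ => f ((extChartAt I x).symm ξ))
      (extChartAt I x).target where
  toIsMetricOn := isMetricOn_metricInChart g x
  flat _ hξ := curvature_metricInChart g hflat hξ
  contDiffOn_warp := contMDiffOn_iff_contDiffOn.1
    (hf.comp_contMDiffOn (contMDiffOn_extChartAt_symm (I := I) (n := ∞) x))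
  warp_pos _ _ := hpos _

end Riemannian

section TangentCharts

variable {E : Type*} [NormedAddCommGroup E] [NormedSpace ℝ E]
  {H : Type*} [TopologicalSpace H] {I : ModelWithCorners ℝ E H} [I.Boundaryless]
  {M : Type*} [TopologicalSpace M] [ChartedSpace H M] [IsManifold I ∞ M]
  {p q : TangentBundle I M} {z : E × E}

omit [I.Boundaryless] in
lemma extChartAt_tangent_target :
    (extChartAt I.tangent p).target = (extChartAt I p.proj).target ×ˢ univ := by
  rw [FiberBundle.extChartAt_target, inter_eq_left.2]
  intro ξ hξ
  have hq := (extChartAt I p.proj).map_target hξ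
  rwa [extChartAt_source] at hq

lemma extChartAt_tangent_symm (hz : z.1 ∈ (extChartAt I p.proj).target) :
    (extChartAt I.tangent p).symm z
      = (⟨(extChartAt I p.proj).symm z.1,
          fderiv ℝ (chartTransition I p.proj ((extChartAt I p.proj).symm z.1)) z.1 z.2⟩ :
            TangentBundle I M) := by
  have hq := (extChartAt I p.proj).map_target hz
  rw [extChartAt_source] at hq
  rw [← symmL_trivializationAt hz, FiberBundle.extChartAt]
  exact (((trivializationAt E (TangentSpace I : M → Type _) p.proj).mk_symm hq z.2).symm).trans
    (congrArg (TotalSpace.mk' E _)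
      ((trivializationAt E (TangentSpace I) p.proj).symmL_apply (R := ℝ) hq z.2).symm)

lemma extChartAt_tangent_apply (y : M) (v : E) :
    extChartAt I.tangent q (⟨y, v⟩ : TangentBundle I M)
      = (extChartAt I q.proj y,
          fderiv ℝ (chartTransition I y q.proj) (extChartAt I y y) v) := by
  rw [FiberBundle.extChartAt]
  have h := TangentBundle.trivializationAt_apply (I := I) q.proj (⟨y, v⟩ : TangentBundle I M)
  rw [I.range_eq_univ, fderivWithin_univ] at h
  refine Prod.ext rfl ?_
  have h' := congrArg Prod.snd h
  exact h'

lemma chartTransition_tangent (hz : z.1 ∈ (extChartAt I p.proj).target)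
    (hq : (extChartAt I p.proj).symm z.1 ∈ (extChartAt I q.proj).source) :
    chartTransition I.tangent p q z
      = (chartTransition I p.proj q.proj z.1,
          fderiv ℝ (chartTransition I p.proj q.proj) z.1 z.2) := by
  rw [chartTransition, extChartAt_tangent_symm hz, extChartAt_tangent_apply,
    ← fderiv_chartTransition_comp hz (mem_extChartAt_source _) hq]
  rfl

lemma fderiv_chartTransition_tangent (hz : z.1 ∈ (extChartAt I p.proj).target)
    (hq : (extChartAt I p.proj).symm z.1 ∈ (extChartAt I q.proj).source) (v : E × E) :
    fderiv ℝ (chartTransition I.tangent p q) z v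
      = (fderiv ℝ (chartTransition I p.proj q.proj) z.1 v.1,
          fderiv ℝ (fderiv ℝ (chartTransition I p.proj q.proj)) z.1 v.1 z.2
            + fderiv ℝ (chartTransition I p.proj q.proj) z.1 v.2) := by
  set ψ := chartTransition I p.proj q.proj with hψdef
  have hψ : ContDiffAt ℝ ∞ ψ z.1 := contDiffAt_chartTransition hz hq
  have he : chartTransition I.tangent p q =ᶠ[𝓝 z] fun ζ => (ψ ζ.1, fderiv ℝ ψ ζ.1 ζ.2) := by
    filter_upwards [continuousAt_fst.eventually (eventually_symm_mem_source hz hq)] with ζ hζ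
    exact chartTransition_tangent hζ.1 hζ.2
  have h1 : DifferentiableAt ℝ ψ z.1 := hψ.differentiableAt (by simp)
  have h2 : DifferentiableAt ℝ (fderiv ℝ ψ) z.1 :=
    (hψ.fderiv_right (m := ∞) (by simp)).differentiableAt (by simp)
  have h3 := h1.hasFDerivAt.comp z hasFDerivAt_fst
  have h4 := (h2.hasFDerivAt.comp z hasFDerivAt_fst).clm_apply hasFDerivAt_snd
  rw [he.fderiv_eq]
  refine (DFunLike.congr_fun (h3.prodMk h4).fderiv v).trans ?_
  simp [add_comm]

variable [FiniteDimensional ℝ E]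

lemma fderiv_chartTransition_injective {x y : M} {ξ : E} (hξ : ξ ∈ (extChartAt I x).target)
    (hy : (extChartAt I x).symm ξ ∈ (extChartAt I y).source) :
    Function.Injective (fderiv ℝ (chartTransition I x y) ξ) :=
  (LinearMap.injective_iff_surjective
    (f := (fderiv ℝ (chartTransition I x y) ξ).toLinearMap)).2
      (fderiv_chartTransition_surjective hξ hy)

variable (g : ContMDiffRiemannianMetric I ∞ E (fun x : M => TangentSpace I x))

/-- The connection map commutes with changes of coordinates. -/
lemma connectionMap_transition (hz : z.1 ∈ (extChartAt I p.proj).target)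
    (hq : (extChartAt I p.proj).symm z.1 ∈ (extChartAt I q.proj).source) (v : E × E) :
    connectionMap (metricInChart g.inner q.proj) (chartTransition I.tangent p q z)
        (fderiv ℝ (chartTransition I.tangent p q) z v)
      = fderiv ℝ (chartTransition I p.proj q.proj) z.1
          (connectionMap (metricInChart g.inner p.proj) z v) := by
  have hψ := (contDiffAt_chartTransition hz hq).of_le (m := 2) ENat.LEInfty.out
  rw [fderiv_chartTransition_tangent hz hq, chartTransition_tangent hz hq, connectionMap_apply,
    connectionMap_apply, map_add, fderiv_christoffel_of_isometry
      (isMetricOn_metricInChart g p.proj) (isMetricOn_metricInChart g q.proj) hz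
      (chartTransition_mem_target hq) hψ (fderiv_chartTransition_surjective hz hq)
      (eventually_isometry g.inner hz hq), covDerivAlong, fderiv_fderiv_const_apply hψ]
  exact (add_assoc _ _ _).trans (add_left_comm _ _ _)

lemma metricInChart_musSasaki (f : M → ℝ) (hz : z.1 ∈ (extChartAt I p.proj).target) :
    metricInChart (musSasaki g.inner f) p z
      = warpedForm (metricInChart g.inner p.proj)
          (fun ξ => f ((extChartAt I p.proj).symm ξ)) z := by
  refine ContinuousLinearMap.ext fun u => ContinuousLinearMap.ext fun v => ?_
  have hzt : z ∈ (extChartAt I.tangent p).target := by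
    rw [extChartAt_tangent_target]
    exact ⟨hz, mem_univ _⟩
  rw [metricInChart_eq_fderiv _ hzt, extChartAt_tangent_symm hz, warpedForm_apply]
  set y := (extChartAt I p.proj).symm z.1 with hy
  set q : TangentBundle I M := ⟨y, fderiv ℝ (chartTransition I p.proj y) z.1 z.2⟩ with hq
  have hyq : (extChartAt I p.proj).symm z.1 ∈ (extChartAt I q.proj).source :=
    mem_extChartAt_source y
  have h1 : ∀ v, (fderiv ℝ (chartTransition I.tangent p q) z v).1
      = fderiv ℝ (chartTransition I p.proj y) z.1 v.1 := fun v => by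
    rw [fderiv_chartTransition_tangent hz hyq]
  have h2 : ∀ v, verticalPart g.inner q (fderiv ℝ (chartTransition I.tangent p q) z v)
      = fderiv ℝ (chartTransition I p.proj y) z.1
          (connectionMap (metricInChart g.inner p.proj) z v) := fun v => by
    have h := connectionMap_transition g hz hyq v
    rw [chartTransition_tangent hz hyq] at h
    exact h
  rw [metricInChart_eq_fderiv _ hz, metricInChart_eq_fderiv _ hz, ← h1, ← h1, ← h2, ← h2]
  rfl

lemma metricInChart_sasaki (hz : z.1 ∈ (extChartAt I p.proj).target) :
    metricInChart (sasaki g.inner) p z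
      = warpedForm (metricInChart g.inner p.proj) (fun _ => 1) z := by
  have h : sasaki g.inner = musSasaki g.inner fun _ => 1 := by
    funext q
    simp only [sasaki, musSasaki, one_smul]
  rw [h, metricInChart_musSasaki g _ hz]

lemma alongInChart_horizontalLift (X : ∀ x : M, TangentSpace I x)
    (hz : z.1 ∈ (extChartAt I p.proj).target) :
    alongInChart (I := I.tangent) (J := I.tangent) (id : TangentBundle I M → TangentBundle I M)
        (fun q => horizontalLift g.inner q (X q.proj)) p z
      = horizontalIn (metricInChart g.inner p.proj) z
          (alongInChart (I := I) (J := I) (id : M → M) X p.proj z.1) := by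
  have hzt : z ∈ (extChartAt I.tangent p).target := by
    rw [extChartAt_tangent_target]
    exact ⟨hz, mem_univ _⟩
  set A : E × E := alongInChart (I := I.tangent) (J := I.tangent)
    (id : TangentBundle I M → TangentBundle I M)
    (fun q => horizontalLift g.inner q (X q.proj)) p z with hA
  have h := symmL_alongInChart_id (I := I.tangent)
    (fun q : TangentBundle I M => horizontalLift g.inner q (X q.proj)) hzt
  rw [← hA, extChartAt_tangent_symm hz] at h
  have hX := symmL_alongInChart_id X hz
  set y := (extChartAt I p.proj).symm z.1 with hy
  set q : TangentBundle I M := ⟨y, fderiv ℝ (chartTransition I p.proj y) z.1 z.2⟩ with hq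
  have hyq : (extChartAt I p.proj).symm z.1 ∈ (extChartAt I q.proj).source :=
    mem_extChartAt_source y
  have hinj := fderiv_chartTransition_injective hz hyq
  have hlift : (show E × E from horizontalLift g.inner q (X q.proj))
      = horizontalIn (metricInChart g.inner q.proj) (chartTransition I.tangent p q z)
          (show E from X y) := by
    rw [chartTransition_tangent hz hyq]
    rfl
  rw [hlift] at h
  have h1 : A.1 = alongInChart (I := I) (J := I) (id : M → M) X p.proj z.1 := by
    refine hinj ?_
    have h' := congrArg Prod.fst h
    rw [fderiv_chartTransition_tangent hz hyq] at h'
    exact h'.trans hX.symm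
  have h2 : connectionMap (metricInChart g.inner p.proj) z A = 0 := by
    refine hinj ?_
    rw [← connectionMap_transition g hz hyq, h, connectionMap_horizontalIn, map_zero]
  rw [eq_horizontalIn h2, h1]

end TangentCharts

section Gradient

variable {E : Type*} [NormedAddCommGroup E] [NormedSpace ℝ E] [FiniteDimensional ℝ E]
  {H : Type*} [TopologicalSpace H] {I : ModelWithCorners ℝ E H} [I.Boundaryless]
  {M : Type*} [TopologicalSpace M] [ChartedSpace H M] [IsManifold I ∞ M]
  (g : ContMDiffRiemannianMetric I ∞ E (fun x : M => TangentSpace I x)) {f : M → ℝ}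
  {x : M} {ξ : E}

omit [FiniteDimensional ℝ E] in
lemma fderiv_comp_extChartAt_symm (hξ : ξ ∈ (extChartAt I x).target)
    (hf : MDifferentiableAt I 𝓘(ℝ, ℝ) f ((extChartAt I x).symm ξ)) (v : E) :
    fderiv ℝ (fun ζ => f ((extChartAt I x).symm ζ)) ξ v
      = (show E →L[ℝ] ℝ from mfderiv I 𝓘(ℝ, ℝ) f ((extChartAt I x).symm ξ))
          (fderiv ℝ (chartTransition I x ((extChartAt I x).symm ξ)) ξ v) := by
  set y := (extChartAt I x).symm ξ with hy
  have hyy : (extChartAt I x).symm ξ ∈ (extChartAt I y).source := mem_extChartAt_source y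
  have he : (fun ζ => f ((extChartAt I x).symm ζ))
      =ᶠ[𝓝 ξ] (fun η => f ((extChartAt I y).symm η)) ∘ chartTransition I x y := by
    filter_upwards [eventually_symm_mem_source hξ hyy] with ζ hζ
    rw [Function.comp, symm_chartTransition hζ.2]
  have hd : DifferentiableAt ℝ (fun η => f ((extChartAt I y).symm η)) (extChartAt I y y) := by
    have := hf.differentiableWithinAt_writtenInExtChartAt
    rw [I.range_eq_univ, differentiableWithinAt_univ] at this
    exact this
  have hm : (mfderiv I 𝓘(ℝ, ℝ) f y : E →L[ℝ] ℝ)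
      = fderiv ℝ (fun η => f ((extChartAt I y).symm η)) (extChartAt I y y) := by
    rw [hf.mfderiv, I.range_eq_univ, fderivWithin_univ]
    rfl
  rw [he.fderiv_eq, fderiv_comp ξ hd
    ((contDiffAt_chartTransition hξ hyy).differentiableAt (by simp)), ContinuousLinearMap.comp_apply]
  exact congrArg (fun l : E →L[ℝ] ℝ => l (fderiv ℝ (chartTransition I x y) ξ v)) hm.symm

lemma alongInChart_grad (hξ : ξ ∈ (extChartAt I x).target)
    (hf : MDifferentiableAt I 𝓘(ℝ, ℝ) f ((extChartAt I x).symm ξ)) :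
    alongInChart (I := I) (J := I) (id : M → M) (grad g.inner f) x ξ
      = gradIn (metricInChart g.inner x) (fun ζ => f ((extChartAt I x).symm ζ)) ξ := by
  have hG := isMetricOn_metricInChart g x
  refine hG.eq_of_forall hξ fun v => ?_
  rw [hG.gradIn_apply hξ, fderiv_comp_extChartAt_symm hξ hf, metricInChart_eq_fderiv _ hξ,
    symmL_alongInChart_id _ hξ]
  have hinv : (g.inner ((extChartAt I x).symm ξ)).IsInvertible :=
    isInvertible_of_pos (E := E) (g.pos _)
  exact congrArg (fun l : E →L[ℝ] ℝ => l _) (hinv.self_apply_inverse _)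

lemma grad_eq_gradIn (hf : MDifferentiableAt I 𝓘(ℝ, ℝ) f x) :
    grad g.inner f x = gradIn (metricInChart g.inner x) (fun ζ => f ((extChartAt I x).symm ζ))
      (extChartAt I x x) := by
  have hx := mem_extChartAt_target (I := I) x
  have h1 := alongInChart_grad g hx (f := f) (by rwa [extChartAt_to_inv])
  have h2 := symmL_alongInChart_id (grad g.inner f) hx
  rw [extChartAt_to_inv, fderiv_chartTransition_self hx, h1] at h2
  exact h2.symm

/-- `|grad f|²` in coordinates. -/
lemma inner_grad_grad (hf : ContMDiff I 𝓘(ℝ, ℝ) ∞ f) (hξ : ξ ∈ (extChartAt I x).target) :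
    g.inner ((extChartAt I x).symm ξ) (grad g.inner f ((extChartAt I x).symm ξ))
        (grad g.inner f ((extChartAt I x).symm ξ))
      = metricInChart g.inner x ξ
          (gradIn (metricInChart g.inner x) (fun ζ => f ((extChartAt I x).symm ζ)) ξ)
          (gradIn (metricInChart g.inner x) (fun ζ => f ((extChartAt I x).symm ζ)) ξ) := by
  rw [← alongInChart_grad g hξ (hf.mdifferentiableAt (by simp)), metricInChart_eq_fderiv _ hξ,
    symmL_alongInChart_id _ hξ]
  rfl

omit [FiniteDimensional ℝ E] [I.Boundaryless] [IsManifold I ∞ M] in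
lemma mdifferentiableAt_of_differentiableAt_comp_symm
    (hf : DifferentiableAt ℝ (fun ζ => f ((extChartAt I x).symm ζ)) (extChartAt I x x)) :
    MDifferentiableAt I 𝓘(ℝ, ℝ) f x := by
  have h1 : MDifferentiableAt I 𝓘(ℝ, E) (extChartAt I x) x :=
    (contMDiffAt_extChartAt (n := ∞)).mdifferentiableAt (by simp)
  have h2 := MDifferentiableAt.comp x hf.mdifferentiableAt h1
  refine h2.congr_of_eventuallyEq ?_
  filter_upwards [extChartAt_source_mem_nhds (I := I) x] with y hy
  rw [Function.comp, (extChartAt I x).left_inv hy]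

end Gradient

section IdentityMap

variable {E : Type*} [NormedAddCommGroup E] [NormedSpace ℝ E] [FiniteDimensional ℝ E]
  {H : Type*} [TopologicalSpace H] {I : ModelWithCorners ℝ E H} [I.Boundaryless]
  {M : Type*} [TopologicalSpace M] [ChartedSpace H M] [IsManifold I ∞ M]
  (g : ContMDiffRiemannianMetric I ∞ E (fun x : M => TangentSpace I x)) {f : M → ℝ}

omit [FiniteDimensional ℝ E] in
lemma extChartAt_tangent_self (p : TangentBundle I M) :
    extChartAt I.tangent p p = (extChartAt I p.proj p.proj, (show E from p.snd)) := by
  have h := extChartAt_tangent_apply (I := I) (q := p) p.proj p.snd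
  exact h.trans (Prod.ext rfl (fderiv_chartTransition_self (I := I)
    (mem_extChartAt_target p.proj) (show E from p.snd)))

omit [FiniteDimensional ℝ E] in
lemma extChartAt_tangent_self_mem (p : TangentBundle I M) :
    (extChartAt I.tangent p p).1 ∈ (extChartAt I p.proj).target := by
  rw [extChartAt_tangent_self]
  exact mem_extChartAt_target _

omit [FiniteDimensional ℝ E] in
lemma eventually_fst_mem_target (p : TangentBundle I M) :
    ∀ᶠ z in 𝓝 (extChartAt I.tangent p p), z.1 ∈ (extChartAt I p.proj).target :=
  continuousAt_fst.eventually
    ((isOpen_extChartAt_target p.proj).mem_nhds (extChartAt_tangent_self_mem p))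

omit [FiniteDimensional ℝ E] in
lemma horizontalLift_eq_horizontalIn (p : TangentBundle I M) (X : TangentSpace I p.proj) :
    horizontalLift g.inner p X = horizontalIn (metricInChart g.inner p.proj)
      (extChartAt I.tangent p p) X := by
  rw [extChartAt_tangent_self]
  rfl

lemma metricInChart_musSasaki_eventuallyEq (f : M → ℝ) (p : TangentBundle I M) :
    metricInChart (musSasaki g.inner f) p =ᶠ[𝓝 (extChartAt I.tangent p p)]
      warpedForm (metricInChart g.inner p.proj) fun ξ => f ((extChartAt I p.proj).symm ξ) :=
  (eventually_fst_mem_target p).mono fun _ hz => metricInChart_musSasaki g f hz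

lemma metricInChart_sasaki_eventuallyEq (p : TangentBundle I M) :
    metricInChart (sasaki g.inner) p =ᶠ[𝓝 (extChartAt I.tangent p p)]
      warpedForm (metricInChart g.inner p.proj) fun _ => 1 :=
  (eventually_fst_mem_target p).mono fun _ hz => metricInChart_sasaki g hz

lemma traceAt_sasaki {F : Type*} [NormedAddCommGroup F] [NormedSpace ℝ F] (p : TangentBundle I M)
    (B : E × E → E × E → F) :
    traceAt (sasaki g.inner) p B
      = metricTrace (warpedForm (metricInChart g.inner p.proj) (fun _ => 1)
          (extChartAt I.tangent p p)) B := by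
  rw [← metricInChart_sasaki g (extChartAt_tangent_self_mem p), metricInChart_center]
  rfl

/-- The tension field of the identity map between the Sasaki and Mus-Sasaki metrics. -/
lemma tensionField_sasaki_musSasaki (hflat : IsFlat g.inner) (hf : ContMDiff I 𝓘(ℝ, ℝ) ∞ f)
    (hpos : ∀ x, 0 < f x) (p : TangentBundle I M) :
    tensionField (sasaki g.inner) (musSasaki g.inner f)
        (id : TangentBundle I M → TangentBundle I M) p
      = horizontalLift g.inner p
          (-((Module.finrank ℝ E : ℝ) / 2) • grad g.inner f p.proj) := by
  have hB : secondFundamentalForm (metricInChart (sasaki g.inner) p)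
      (metricInChart (musSasaki g.inner f) p)
      (writtenInExtChartAt I.tangent I.tangent p (id : TangentBundle I M → TangentBundle I M))
      (extChartAt I.tangent p p)
      = secondFundamentalForm (warpedForm (metricInChart g.inner p.proj) fun _ => 1)
        (warpedForm (metricInChart g.inner p.proj) fun ξ => f ((extChartAt I p.proj).symm ξ))
        id (extChartAt I.tangent p p) := by
    funext u v
    rw [secondFundamentalForm_of_eventuallyEq_id writtenInExtChartAt_id,
      secondFundamentalForm_of_eventuallyEq_id (EventuallyEq.refl _ _),
      christoffel_congr (metricInChart_sasaki_eventuallyEq g p),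
      christoffel_congr (metricInChart_musSasaki_eventuallyEq g f p)]
  have h := (isFlatWarpingOn g hflat hf hpos p.proj).tension_warpedForm
    (extChartAt_tangent_self_mem p) (EventuallyEq.refl _ _)
  rw [← hB, ← traceAt_sasaki] at h
  refine h.trans ?_
  rw [horizontalLift_eq_horizontalIn, grad_eq_gradIn g (hf.mdifferentiableAt (by simp)),
    extChartAt_tangent_self]
  rfl

lemma grad_inner_grad (hf : ContMDiff I 𝓘(ℝ, ℝ) ∞ f) (x : M) :
    grad g.inner (fun y => g.inner y (grad g.inner f y) (grad g.inner f y)) x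
      = gradIn (metricInChart g.inner x)
          (fun ζ => metricInChart g.inner x ζ
            (gradIn (metricInChart g.inner x) (fun ζ => f ((extChartAt I x).symm ζ)) ζ)
            (gradIn (metricInChart g.inner x) (fun ζ => f ((extChartAt I x).symm ζ)) ζ))
          (extChartAt I x x) := by
  have hG := isMetricOn_metricInChart g x
  have hx := mem_extChartAt_target (I := I) x
  have hfc : ContDiffOn ℝ ∞ (fun ζ => f ((extChartAt I x).symm ζ)) (extChartAt I x).target :=
    contMDiffOn_iff_contDiffOn.1
      (hf.comp_contMDiffOn (contMDiffOn_extChartAt_symm (I := I) (n := ∞) x))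
  set h : M → ℝ := fun y => g.inner y (grad g.inner f y) (grad g.inner f y) with hh
  have he : (fun ζ => h ((extChartAt I x).symm ζ)) =ᶠ[𝓝 (extChartAt I x x)]
      fun ζ => metricInChart g.inner x ζ
        (gradIn (metricInChart g.inner x) (fun ζ => f ((extChartAt I x).symm ζ)) ζ)
        (gradIn (metricInChart g.inner x) (fun ζ => f ((extChartAt I x).symm ζ)) ζ) :=
    eventually_of_mem (extChartAt_target_mem_nhds (I := I) x)
      fun ζ hζ => inner_grad_grad g hf hζ
  have hN := (hG.contDiffAt_gradIn hfc hx).differentiableAt (by simp)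
  have hd := ((hG.differentiableAt hx).clm_apply hN).clm_apply hN
  rw [grad_eq_gradIn g
    (mdifferentiableAt_of_differentiableAt_comp_symm (hd.congr_of_eventuallyEq he)), gradIn, gradIn,
    EventuallyEq.fderiv_eq he]

lemma alongInChart_grad_eventuallyEq (hf : ContMDiff I 𝓘(ℝ, ℝ) ∞ f) (x : M) :
    alongInChart (I := I) (J := I) (id : M → M) (grad g.inner f) x =ᶠ[𝓝 (extChartAt I x x)]
      gradIn (metricInChart g.inner x) (fun ζ => f ((extChartAt I x).symm ζ)) :=
  eventually_of_mem (extChartAt_target_mem_nhds (I := I) x) fun _ hξ =>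
    alongInChart_grad g hξ (hf.mdifferentiableAt (by simp))

lemma traceHessianField_grad (hf : ContMDiff I 𝓘(ℝ, ℝ) ∞ f) (x : M) :
    traceHessianField g.inner (grad g.inner f) x
      = metricTrace (metricInChart g.inner x (extChartAt I x x))
          (secondCovDerivAlong (metricInChart g.inner x) (metricInChart g.inner x) id
            (gradIn (metricInChart g.inner x) (fun ζ => f ((extChartAt I x).symm ζ)))
            (extChartAt I x x)) := by
  have hB : secondCovDerivAlong (metricInChart g.inner x) (metricInChart g.inner x)
      (writtenInExtChartAt I I x (id : M → M))
      (alongInChart (I := I) (J := I) (id : M → M) (grad g.inner f) x) (extChartAt I x x)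
      = secondCovDerivAlong (metricInChart g.inner x) (metricInChart g.inner x) id
            (gradIn (metricInChart g.inner x) (fun ζ => f ((extChartAt I x).symm ζ)))
            (extChartAt I x x) := by
    funext u v
    exact secondCovDerivAlong_congr writtenInExtChartAt_id (alongInChart_grad_eventuallyEq g hf x)
      u v
  rw [← hB, metricInChart_center]
  rfl

/-- The bitension field of the identity map between the Sasaki and Mus-Sasaki metrics. -/
lemma bitensionField_sasaki_musSasaki (hflat : IsFlat g.inner) (hf : ContMDiff I 𝓘(ℝ, ℝ) ∞ f)
    (hpos : ∀ x, 0 < f x) (p : TangentBundle I M) :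
    bitensionField (sasaki g.inner) (musSasaki g.inner f)
        (id : TangentBundle I M → TangentBundle I M) p
      = -((Module.finrank ℝ E : ℝ) ^ 2 / 8) •
          horizontalLift g.inner p
            (grad g.inner (fun x => g.inner x (grad g.inner f x) (grad g.inner f x)) p.proj)
        + ((Module.finrank ℝ E : ℝ) / 2) •
          horizontalLift g.inner p (traceHessianField g.inner (grad g.inner f) p.proj) := by
  have hW := isFlatWarpingOn g hflat hf hpos p.proj
  have hz := extChartAt_tangent_self_mem p
  have hz1 : (extChartAt I.tangent p p).1 = extChartAt I p.proj p.proj := by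
    rw [extChartAt_tangent_self]
  set m : ℝ := ((Module.finrank ℝ E : ℕ) : ℝ)
  set G := metricInChart g.inner p.proj with hG
  set F : E → ℝ := fun ξ => f ((extChartAt I p.proj).symm ξ) with hF
  set z := extChartAt I.tangent p p with hzdef
  set X : ∀ x : M, TangentSpace I x := fun x => -(m / 2) • grad g.inner f x with hX
  have hτ : tensionField (sasaki g.inner) (musSasaki g.inner f)
      (id : TangentBundle I M → TangentBundle I M)
      = fun q => horizontalLift g.inner q (X q.proj) :=
    funext fun q => tensionField_sasaki_musSasaki g hflat hf hpos q
  have hcurv : traceCurvature (sasaki g.inner) (musSasaki g.inner f)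
      (id : TangentBundle I M → TangentBundle I M)
      (fun q => horizontalLift g.inner q (X q.proj)) p
      = metricTrace (warpedForm G (fun _ => 1) z)
        (curvature (warpedForm G F) z (horizontalIn G z (-(m / 2) • gradIn G F z.1))) := by
    have h1 : curvature (metricInChart (musSasaki g.inner f) p) z = curvature (warpedForm G F) z :=
      curvature_congr (metricInChart_musSasaki_eventuallyEq g f p)
    have h2 : (show E × E from horizontalLift g.inner p (X p.proj))
        = horizontalIn G z (-(m / 2) • gradIn G F z.1) := by
      rw [hz1, ← grad_eq_gradIn g (hf.mdifferentiableAt (by simp))]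
      exact horizontalLift_eq_horizontalIn g p _
    rw [← traceAt_sasaki, ← h1, ← h2]
    simp only [traceCurvature, mfderiv_id]
    rfl
  have hcov : traceSecondCovDeriv (sasaki g.inner) (musSasaki g.inner f)
      (id : TangentBundle I M → TangentBundle I M)
      (fun q => horizontalLift g.inner q (X q.proj)) p
      = metricTrace (warpedForm G (fun _ => 1) z)
          (secondCovDerivAlong (warpedForm G fun _ => 1) (warpedForm G F) id
            (fun ζ => horizontalIn G ζ (-(m / 2) • gradIn G F ζ.1)) z) := by
    have hV : alongInChart (I := I.tangent) (J := I.tangent)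
        (id : TangentBundle I M → TangentBundle I M)
        (fun q => horizontalLift g.inner q (X q.proj)) p
        =ᶠ[𝓝 z] fun ζ => horizontalIn G ζ (-(m / 2) • gradIn G F ζ.1) := by
      filter_upwards [eventually_fst_mem_target p] with ζ hζ
      rw [alongInChart_horizontalLift g X hζ,
        ← alongInChart_grad g hζ (hf.mdifferentiableAt (by simp))]
      congr 1
      exact map_smul _ _ _
    have hB : secondCovDerivAlong (metricInChart (sasaki g.inner) p)
        (metricInChart (musSasaki g.inner f) p)
        (writtenInExtChartAt I.tangent I.tangent p (id : TangentBundle I M → TangentBundle I M))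
        (alongInChart (I := I.tangent) (J := I.tangent)
          (id : TangentBundle I M → TangentBundle I M)
          (fun q => horizontalLift g.inner q (X q.proj)) p) z
        = secondCovDerivAlong (warpedForm G fun _ => 1) (warpedForm G F) id
            (fun ζ => horizontalIn G ζ (-(m / 2) • gradIn G F ζ.1)) z := by
      funext u v
      rw [secondCovDerivAlong_congr writtenInExtChartAt_id hV]
      exact secondCovDerivAlong_congr_metric (φ := id) (metricInChart_sasaki_eventuallyEq g p)
        (metricInChart_musSasaki_eventuallyEq g f p) continuousAt_id u v
    rw [← hB, ← traceAt_sasaki]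
    rfl
  have key := hW.bitension_warpedForm hz
  rw [bitensionField, hτ, jacobiOperator, hcurv, hcov, horizontalLift_eq_horizontalIn,
    horizontalLift_eq_horizontalIn, grad_inner_grad g hf, traceHessianField_grad g hf, ← hz1]
  exact key

end IdentityMap

end RiemGeom

end

theorem theorem5p3
    {E : Type*} [NormedAddCommGroup E] [NormedSpace ℝ E] [FiniteDimensional ℝ E]
    {M : Type*} [TopologicalSpace M] [ChartedSpace E M] [IsManifold 𝓘(ℝ, E) ∞ M]
    (m : ℕ) (hm : Module.finrank ℝ E = m)
    (g : Bundle.ContMDiffRiemannianMetric 𝓘(ℝ, E) ∞ E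
      (fun x : M => TangentSpace 𝓘(ℝ, E) x))
    (hflat : RiemGeom.IsFlat g.inner)
    (f : M → ℝ) (hf : ContMDiff 𝓘(ℝ, E) 𝓘(ℝ, ℝ) ∞ f) (hpos : ∀ x, 0 < f x)
    (p : TangentBundle 𝓘(ℝ, E) M) :
    RiemGeom.tensionField (RiemGeom.sasaki g.inner) (RiemGeom.musSasaki g.inner f)
        (id : TangentBundle 𝓘(ℝ, E) M → TangentBundle 𝓘(ℝ, E) M) p
      = -((m : ℝ) / 2) •
          RiemGeom.horizontalLift g.inner p (RiemGeom.grad g.inner f p.proj) ∧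
    RiemGeom.bitensionField (RiemGeom.sasaki g.inner) (RiemGeom.musSasaki g.inner f)
        (id : TangentBundle 𝓘(ℝ, E) M → TangentBundle 𝓘(ℝ, E) M) p
      = -((m : ℝ) ^ 2 / 8) •
          RiemGeom.horizontalLift g.inner p
            (RiemGeom.grad g.inner
              (fun x => g.inner x (RiemGeom.grad g.inner f x) (RiemGeom.grad g.inner f x)) p.proj)
        + ((m : ℝ) / 2) •
          RiemGeom.horizontalLift g.inner p
            (RiemGeom.traceHessianField g.inner (RiemGeom.grad g.inner f) p.proj) := by
  subst hm
  refine ⟨?_, RiemGeom.bitensionField_sasaki_musSasaki g hflat hf hpos p⟩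
  rw [RiemGeom.tensionField_sasaki_musSasaki g hflat hf hpos p,
    RiemGeom.horizontalLift_eq_horizontalIn, RiemGeom.horizontalLift_eq_horizontalIn]
  exact RiemGeom.horizontalIn_smul _ _
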